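/- Let $N\ge 1$ be an integer, let $\mathbb{B}_N$ and $\mathbb{S}_N$ be the open unit ball and the unit sphere of $\mathbb{C}^N$, and let $\alpha>-1$. Let $v$ be the Lebesgue measure on $\mathbb{B}_N$ normalized by $v(\mathbb{B}_N)=1$, and let $$dv_\alpha(z)=c_\alpha(1-|z|^2)^\alpha\,dv(z),\qquad c_\alpha=\frac{\Gamma(N+\alpha+1)}{N!\,\Gamma(\alpha+1)}.$$ An Orlicz function is a strictly convex function $\psi:[0,\infty)\to[0,\infty)$ with $\psi(0)=0$, continuous at $0$, such that $\psi(x)/x\to+\infty$ as $x\to\infty$. It satisfies the $\Delta_2$-Condition if there are $x_0>0$ and $K>1$ with $\psi(2x)\le K\psi(x)$ for all $x\ge x_0$. The weighted Bergman–Orlicz space $A^\psi_\alpha(\mathbb{B}_N)$ consists of the holomorphic functions $f$ on $\mathbb{B}_N$ with $\int_{\mathbb{B}_N}\psi(|f|/C)\,dv_\alpha<\infty$ for some $C>0$, with the Luxemburg norm $\|f\|_\psi=\inf\{C>0:\int_{\mathbb{B}_N}\psi(|f|/C)\,dv_\alpha\le 1\}$. For $\xi\in\mathbb{S}_N$ and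 $0<h\le 1$ let $$W(\xi,h)=\Big\{z\in\mathbb{B}_N\setminus\{0\}:\ 1-|z|<h,\ \Big|1-\Big\langle \tfrac{z}{|z|},\xi\Big\rangle\Big|<h\Big\},$$ and for a positive Borel measure $\mu$ on $\mathbb{B}_N$ let $$\varrho_\mu(h)=\sup_{\xi\in\mathbb{S}_N}\mu(W(\xi,h)),\qquad K_{\mu,\alpha}(h)=\sup_{0<t\le h}\frac{\varrho_\mu(t)}{t^{N+1+\alpha}}.$$ The measure $\mu$ is an $\alpha$-Bergman–Carleson measure if $K_{\mu,\alpha}$ is bounded on $(0,1]$, and a vanishing $\alpha$-Bergman–Carleson measure if $\varrho_\mu(h)/h^{N+1+\alpha}\to 0$ as $h\to 0^+$. **Theorem 3.3.** Let $\psi$ be an Orlicz function satisfying the $\Delta_2$-Condition, let $\phi:\mathbb{B}_N\to\mathbb{B}_N$ be holomorphic, let $C_\phi(f)=f\circ\phi$, and let $\mu_\phi^\alpha$ be the measure on $\mathbb{B}_N$ given by $\mu_\phi^\alpha(E)=v_\alpha(\phi^{-1}(E))$ for every Borel set $E\subset\mathbb{B}_N$. Then: 1. $C_\phi$ is bounded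 from $A^\psi_\alpha(\mathbb{B}_N)$ into itself if and only if $\mu_\phi^\alpha$ is an $\alpha$-Bergman–Carleson measure. 2. $C_\phi$ is compact from $A^\psi_\alpha(\mathbb{B}_N)$ into itself if and only if $\mu_\phi^\alpha$ is a vanishing $\alpha$-Bergman–Carleson measure. -/

import Mathlib

open MeasureTheory Set Filter Topology
open scoped ENNReal NNReal Nat

noncomputable section

/-- An Orlicz function `ψ : ℝ₊ → ℝ₊`: strictly convex, vanishing at `0`, continuous at `0`, with
`ψ x / x → ∞` as `x → ∞`. It is represented by a function on `ℝ`; only its values on `[0, ∞)` are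
constrained, and only those are ever used. -/
structure OrliczFunction where
  toFun : ℝ → ℝ
  nonneg' : ∀ x, 0 ≤ x → 0 ≤ toFun x
  strictConvexOn' : StrictConvexOn ℝ (Ici 0) toFun
  map_zero' : toFun 0 = 0
  continuousAt_zero' : ContinuousWithinAt toFun (Ici 0) 0
  superlinear' : Tendsto (fun x => toFun x / x) atTop atTop

instance : CoeFun OrliczFunction (fun _ => ℝ → ℝ) := ⟨OrliczFunction.toFun⟩

namespace OrliczFunction

/-- The `Δ₂`-condition: `ψ (2 x) ≤ K ψ x` for all large `x`. -/
def DeltaTwo (ψ : OrliczFunction) : Prop :=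
  ∃ x₀ > (0 : ℝ), ∃ K > (1 : ℝ), ∀ x, x₀ ≤ x → ψ (2 * x) ≤ K * ψ x

variable (ψ : OrliczFunction)

lemma map_div_le {x t : ℝ} (hx : 0 ≤ x) (ht : 1 ≤ t) : ψ (x / t) ≤ ψ x / t := by
  have ht0 : 0 ≤ 1 / t := by positivity
  have ht1 : 0 ≤ 1 - 1 / t := by rw [sub_nonneg, div_le_one (by linarith)]; exact ht
  have h := ψ.strictConvexOn'.convexOn.2 (mem_Ici.2 hx) (mem_Ici.2 le_rfl) ht0 ht1 (by ring)
  simp only [smul_eq_mul, mul_zero, add_zero, ψ.map_zero'] at h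
  calc ψ (x / t) = ψ (1 / t * x) := by congr 1; ring
    _ ≤ 1 / t * ψ x := h
    _ = ψ x / t := by ring

lemma monotoneOn : MonotoneOn ψ (Ici 0) := by
  intro x hx y hy hxy
  rcases eq_or_lt_of_le (show (0 : ℝ) ≤ x from hx) with h0 | h0
  · rw [← h0, ψ.map_zero']; exact ψ.nonneg' y hy
  · have ht : 1 ≤ y / x := by rw [le_div_iff₀ h0]; linarith
    have h := ψ.map_div_le hy ht
    have e : y / (y / x) = x := div_div_cancel₀ (h0.trans_le hxy).ne'
    rw [e] at h
    exact h.trans (div_le_self (ψ.nonneg' y hy) ht)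

lemma pos {x : ℝ} (hx : 0 < x) : 0 < ψ x := by
  have h2 : (0 : ℝ) < 1 / 2 := by norm_num
  have h := ψ.strictConvexOn'.2 (mem_Ici.2 hx.le) (mem_Ici.2 le_rfl) hx.ne' h2 h2 (by norm_num)
  simp only [smul_eq_mul, mul_zero, add_zero, ψ.map_zero'] at h
  have := ψ.nonneg' (1 / 2 * x) (by positivity)
  linarith

lemma measurable_comp_norm {Ω : Type*} [MeasurableSpace Ω] {μ : Measure Ω} {f : Ω → ℂ}
    (hf : AEMeasurable f μ) (C : ℝ) (hC : 0 < C) :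
    AEMeasurable (fun z => ENNReal.ofReal (ψ (‖f z‖ / C))) μ := by
  have hm : Monotone (fun x : ℝ => ψ (max x 0)) := fun x y h =>
    ψ.monotoneOn (mem_Ici.2 (le_max_right _ _)) (mem_Ici.2 (le_max_right _ _))
      (max_le_max_right _ h)
  have h := (hm.measurable.comp_aemeasurable (hf.norm.div_const C)).ennreal_ofReal
  refine h.congr (Eventually.of_forall fun z => ?_)
  have : 0 ≤ ‖f z‖ / C := by positivity
  simp [max_eq_left this]

end OrliczFunction

section Orlicz

variable {Ω : Type*} [MeasurableSpace Ω]

/-- The integral `∫ ψ (|f| / C) dμ`, with values in `[0, ∞]`. -/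
def orliczModular (ψ : OrliczFunction) (μ : Measure Ω) (f : Ω → ℂ) (C : ℝ) : ℝ≥0∞ :=
  ∫⁻ z, ENNReal.ofReal (ψ (‖f z‖ / C)) ∂μ

/-- `f` belongs to the Orlicz space `L^ψ(μ)`. -/
def MemOrlicz (ψ : OrliczFunction) (μ : Measure Ω) (f : Ω → ℂ) : Prop :=
  AEMeasurable f μ ∧ ∃ C : ℝ, 0 < C ∧ orliczModular ψ μ f C < ∞

/-- The Luxemburg norm `‖f‖_ψ = inf {C > 0 : ∫ ψ (|f| / C) dμ ≤ 1}`. -/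
def luxemburgNorm (ψ : OrliczFunction) (μ : Measure Ω) (f : Ω → ℂ) : ℝ :=
  sInf {C : ℝ | 0 < C ∧ orliczModular ψ μ f C ≤ 1}

variable {ψ : OrliczFunction} {μ : Measure Ω} {f g : Ω → ℂ}

lemma orliczModular_mul_le {C t : ℝ} (hC : 0 < C) (ht : 1 ≤ t) :
    orliczModular ψ μ f (C * t) ≤ ENNReal.ofReal t⁻¹ * orliczModular ψ μ f C := by
  unfold orliczModular
  rw [← lintegral_const_mul' _ _ ENNReal.ofReal_ne_top]
  refine lintegral_mono fun z => ?_
  rw [← ENNReal.ofReal_mul (by positivity)]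
  apply ENNReal.ofReal_le_ofReal
  have := ψ.map_div_le (x := ‖f z‖ / C) (by positivity) ht
  rw [div_div] at this
  rw [inv_mul_eq_div]
  exact this

lemma orliczModular_add_le (hf : AEMeasurable f μ) {a b : ℝ} (ha : 0 < a) (hb : 0 < b) :
    orliczModular ψ μ (f + g) (a + b) ≤
      ENNReal.ofReal (a / (a + b)) * orliczModular ψ μ f a +
        ENNReal.ofReal (b / (a + b)) * orliczModular ψ μ g b := by
  unfold orliczModular
  rw [← lintegral_const_mul' _ _ ENNReal.ofReal_ne_top,
    ← lintegral_const_mul' _ _ ENNReal.ofReal_ne_top,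
    ← lintegral_add_left' ((ψ.measurable_comp_norm hf a ha).const_mul _)]
  refine lintegral_mono fun z => ?_
  have hfa : 0 ≤ ‖f z‖ / a := by positivity
  have hgb : 0 ≤ ‖g z‖ / b := by positivity
  have h1 := ψ.nonneg' _ hfa
  have h2 := ψ.nonneg' _ hgb
  rw [← ENNReal.ofReal_mul (by positivity), ← ENNReal.ofReal_mul (by positivity),
    ← ENNReal.ofReal_add (by positivity) (by positivity)]
  apply ENNReal.ofReal_le_ofReal
  have ha' : 0 ≤ a / (a + b) := by positivity
  have hb' : 0 ≤ b / (a + b) := by positivity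
  have hc := ψ.strictConvexOn'.convexOn.2 (mem_Ici.2 hfa) (mem_Ici.2 hgb) ha' hb' (by field_simp)
  simp only [smul_eq_mul] at hc
  refine le_trans (ψ.monotoneOn ?_ ?_ ?_) hc
  · exact mem_Ici.2 (by positivity)
  · exact mem_Ici.2 (by positivity)
  · have e : a / (a + b) * (‖f z‖ / a) + b / (a + b) * (‖g z‖ / b)
        = (‖f z‖ + ‖g z‖) / (a + b) := by field_simp
    rw [e]
    gcongr
    exact norm_add_le _ _

lemma orliczModular_smul {c : ℂ} (hc : c ≠ 0) (C : ℝ) :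
    orliczModular ψ μ (c • f) (‖c‖ * C) = orliczModular ψ μ f C := by
  unfold orliczModular
  refine lintegral_congr fun z => ?_
  have : ‖c‖ ≠ 0 := norm_ne_zero_iff.2 hc
  rw [Pi.smul_apply, norm_smul, mul_div_mul_left _ _ this]

lemma orliczModular_zero (C : ℝ) : orliczModular ψ μ 0 C = 0 := by
  simp [orliczModular, ψ.map_zero']

lemma MemOrlicz.nonempty (hf : MemOrlicz ψ μ f) :
    {C : ℝ | 0 < C ∧ orliczModular ψ μ f C ≤ 1}.Nonempty := by
  obtain ⟨-, C, hC, h⟩ := hf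
  set I := (orliczModular ψ μ f C).toReal
  have ht : 1 ≤ max 1 I := le_max_left _ _
  refine ⟨C * max 1 I, by positivity, (orliczModular_mul_le hC ht).trans ?_⟩
  rw [← ENNReal.ofReal_toReal h.ne, ← ENNReal.ofReal_mul (by positivity), ← ENNReal.ofReal_one]
  apply ENNReal.ofReal_le_ofReal
  rw [inv_mul_le_iff₀ (by positivity), mul_one]
  exact le_max_right _ _

lemma luxemburgNorm_nonneg : 0 ≤ luxemburgNorm ψ μ f :=
  Real.sInf_nonneg fun _ h => h.1.le

lemma luxemburgNorm_le {C : ℝ} (hC : 0 < C) (h : orliczModular ψ μ f C ≤ 1) :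
    luxemburgNorm ψ μ f ≤ C :=
  csInf_le ⟨0, fun _ h => h.1.le⟩ ⟨hC, h⟩

lemma exists_lt_of_luxemburgNorm_lt (hf : MemOrlicz ψ μ f) {r : ℝ}
    (h : luxemburgNorm ψ μ f < r) : ∃ C, 0 < C ∧ C < r ∧ orliczModular ψ μ f C ≤ 1 := by
  obtain ⟨C, hC, hr⟩ := exists_lt_of_csInf_lt hf.nonempty h
  exact ⟨C, hC.1, hr, hC.2⟩

lemma MemOrlicz.zero : MemOrlicz ψ μ (0 : Ω → ℂ) :=
  ⟨aemeasurable_const, 1, one_pos, by rw [orliczModular_zero]; exact ENNReal.zero_lt_top⟩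

lemma MemOrlicz.add (hf : MemOrlicz ψ μ f) (hg : MemOrlicz ψ μ g) : MemOrlicz ψ μ (f + g) := by
  obtain ⟨mf, a, ha, h1⟩ := hf
  obtain ⟨mg, b, hb, h2⟩ := hg
  refine ⟨mf.add mg, a + b, by positivity, (orliczModular_add_le mf ha hb).trans_lt ?_⟩
  exact ENNReal.add_lt_top.2 ⟨ENNReal.mul_lt_top ENNReal.ofReal_lt_top h1,
    ENNReal.mul_lt_top ENNReal.ofReal_lt_top h2⟩

lemma MemOrlicz.smul (c : ℂ) (hf : MemOrlicz ψ μ f) : MemOrlicz ψ μ (c • f) := by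
  rcases eq_or_ne c 0 with rfl | hc
  · rw [zero_smul]; exact MemOrlicz.zero
  · obtain ⟨mf, a, ha, h1⟩ := hf
    exact ⟨mf.const_smul c, ‖c‖ * a, by positivity, by rwa [orliczModular_smul hc]⟩

lemma luxemburgNorm_add_le (hf : MemOrlicz ψ μ f) (hg : MemOrlicz ψ μ g) :
    luxemburgNorm ψ μ (f + g) ≤ luxemburgNorm ψ μ f + luxemburgNorm ψ μ g := by
  refine le_of_forall_pos_le_add fun ε hε => ?_
  obtain ⟨a, ha, har, h1⟩ := exists_lt_of_luxemburgNorm_lt hf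
    (show luxemburgNorm ψ μ f < luxemburgNorm ψ μ f + ε / 2 by linarith)
  obtain ⟨b, hb, hbr, h2⟩ := exists_lt_of_luxemburgNorm_lt hg
    (show luxemburgNorm ψ μ g < luxemburgNorm ψ μ g + ε / 2 by linarith)
  have : luxemburgNorm ψ μ (f + g) ≤ a + b := by
    refine luxemburgNorm_le (by positivity) ((orliczModular_add_le hf.1 ha hb).trans ?_)
    calc _ ≤ ENNReal.ofReal (a / (a + b)) * 1 + ENNReal.ofReal (b / (a + b)) * 1 := by gcongr
      _ = 1 := by
        rw [mul_one, mul_one, ← ENNReal.ofReal_add (by positivity) (by positivity),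
          ← add_div, div_self (by positivity), ENNReal.ofReal_one]
  linarith

lemma luxemburgNorm_zero : luxemburgNorm ψ μ (0 : Ω → ℂ) = 0 := by
  refine le_antisymm (le_of_forall_pos_le_add fun ε hε => ?_) luxemburgNorm_nonneg
  rw [zero_add]
  exact luxemburgNorm_le hε (by rw [orliczModular_zero]; exact zero_le_one)

lemma luxemburgNorm_smul_le (c : ℂ) (hf : MemOrlicz ψ μ f) :
    luxemburgNorm ψ μ (c • f) ≤ ‖c‖ * luxemburgNorm ψ μ f := by
  rcases eq_or_ne c 0 with rfl | hc
  · simp [luxemburgNorm_zero]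
  · have hc' : 0 < ‖c‖ := norm_pos_iff.2 hc
    rw [← div_le_iff₀' hc']
    refine le_csInf hf.nonempty fun C hC => ?_
    rw [div_le_iff₀' hc']
    exact luxemburgNorm_le (mul_pos hc' hC.1) (by rw [orliczModular_smul hc]; exact hC.2)

lemma luxemburgNorm_smul (c : ℂ) (hf : MemOrlicz ψ μ f) :
    luxemburgNorm ψ μ (c • f) = ‖c‖ * luxemburgNorm ψ μ f := by
  refine le_antisymm (luxemburgNorm_smul_le c hf) ?_
  rcases eq_or_ne c 0 with rfl | hc
  · simp [luxemburgNorm_zero]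
  · have h := luxemburgNorm_smul_le c⁻¹ (hf.smul c)
    rw [smul_smul, inv_mul_cancel₀ hc, one_smul, norm_inv] at h
    rwa [← le_inv_mul_iff₀ (norm_pos_iff.2 hc)]

lemma ae_eq_zero_of_luxemburgNorm_eq_zero (hf : MemOrlicz ψ μ f)
    (h : luxemburgNorm ψ μ f = 0) : f =ᵐ[μ] 0 := by
  have key : orliczModular ψ μ f 1 = 0 := by
    refine le_antisymm (ENNReal.le_of_forall_pos_le_add fun ε hε _ => ?_) zero_le
    rw [zero_add]
    obtain ⟨C, hC, hCr, h1⟩ := exists_lt_of_luxemburgNorm_lt hf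
      (show luxemburgNorm ψ μ f < min 1 ε by rw [h]; exact lt_min one_pos (by exact_mod_cast hε))
    have hC1 : C < 1 := hCr.trans_le (min_le_left _ _)
    have := orliczModular_mul_le (ψ := ψ) (μ := μ) (f := f) hC (one_le_inv₀ hC |>.2 hC1.le)
    rw [mul_inv_cancel₀ hC.ne', inv_inv] at this
    calc _ ≤ _ := this
      _ ≤ ENNReal.ofReal C * 1 := by gcongr
      _ ≤ ENNReal.ofReal ε := by
        rw [mul_one]; exact ENNReal.ofReal_le_ofReal (hCr.le.trans (min_le_right _ _))
      _ = ε := by simp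
  rw [orliczModular, lintegral_eq_zero_iff' (ψ.measurable_comp_norm hf.1 1 one_pos)] at key
  filter_upwards [key] with z hz
  simp only [div_one, Pi.zero_apply, ENNReal.ofReal_eq_zero] at hz
  by_contra hne
  exact absurd (ψ.pos (norm_pos_iff.2 hne)) (not_lt.2 hz)

end Orlicz

/-- The open unit ball of `ℂ^N` (for the Hermitian norm), as a type. -/
abbrev UnitBall (N : ℕ) : Type := Metric.ball (0 : EuclideanSpace ℂ (Fin N)) 1

/-- The unit sphere of `ℂ^N`. -/
abbrev unitSphere (N : ℕ) : Set (EuclideanSpace ℂ (Fin N)) :=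
  Metric.sphere (0 : EuclideanSpace ℂ (Fin N)) 1

/-- A map on the open unit ball is holomorphic if it is the restriction of a map that is complex
differentiable at every point of the ball. -/
def IsHolomorphic {N : ℕ} {F : Type*} [NormedAddCommGroup F] [NormedSpace ℂ F]
    (f : UnitBall N → F) : Prop :=
  ∃ g : EuclideanSpace ℂ (Fin N) → F,
    DifferentiableOn ℂ g (Metric.ball 0 1) ∧ ∀ z : UnitBall N, g z = f z

/-- The Lebesgue measure of `ℂ^N` restricted to the unit ball. -/
def ballLebesgue (N : ℕ) : Measure (UnitBall N) :=
  Measure.comap Subtype.val (volume : Measure (EuclideanSpace ℂ (Fin N)))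

/-- The Lebesgue measure `v` on the unit ball, normalized to have total mass one. -/
def normalizedVolume (N : ℕ) : Measure (UnitBall N) :=
  (ballLebesgue N univ)⁻¹ • ballLebesgue N

/-- `c_α = Γ(N + α + 1) / (N! Γ(α + 1))`. -/
def bergmanConst (N : ℕ) (α : ℝ) : ℝ :=
  Real.Gamma (N + α + 1) / (N ! * Real.Gamma (α + 1))

/-- The weighted measure `dv_α(z) = c_α (1 - |z|²)^α dv(z)` on the unit ball. -/
def bergmanMeasure (N : ℕ) (α : ℝ) : Measure (UnitBall N) :=
  (normalizedVolume N).withDensity fun z =>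
    ENNReal.ofReal (bergmanConst N α * (1 - ‖(z : EuclideanSpace ℂ (Fin N))‖ ^ 2) ^ α)

/-- The space `A^ψ_α(𝔹_N)` of holomorphic functions on the ball lying in `L^ψ(v_α)`, as a linear
subspace of the space of all functions on the ball. -/
def bergmanOrliczSubmodule (N : ℕ) (α : ℝ) (ψ : OrliczFunction) :
    Submodule ℂ (UnitBall N → ℂ) where
  carrier := {f | IsHolomorphic f ∧ MemOrlicz ψ (bergmanMeasure N α) f}
  zero_mem' := ⟨⟨0, differentiableOn_const 0, fun _ => rfl⟩, MemOrlicz.zero⟩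
  add_mem' := by
    rintro f g ⟨⟨F, hF, hFf⟩, hf⟩ ⟨⟨G, hG, hGg⟩, hg⟩
    exact ⟨⟨F + G, hF.add hG, fun z => by simp [hFf, hGg]⟩, hf.add hg⟩
  smul_mem' := by
    rintro c f ⟨⟨F, hF, hFf⟩, hf⟩
    exact ⟨⟨c • F, hF.const_smul c, fun z => by simp [hFf]⟩, hf.smul c⟩

lemma IsHolomorphic.continuous {N : ℕ} {F : Type*} [NormedAddCommGroup F] [NormedSpace ℂ F]
    {f : UnitBall N → F} (hf : IsHolomorphic f) : Continuous f := by
  obtain ⟨g, hg, h⟩ := hf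
  have := hg.continuousOn.domRestrict
  convert this using 1
  ext z
  exact (h z).symm

lemma eq_zero_of_ae_eq_zero {N : ℕ} {α : ℝ} (hα : -1 < α) {f : UnitBall N → ℂ}
    (hf : Continuous f) (h : f =ᵐ[bergmanMeasure N α] 0) : f = 0 := by
  have hfin : ballLebesgue N univ ≠ ∞ := by
    rw [ballLebesgue, comap_subtype_coe_apply measurableSet_ball, image_univ, Subtype.range_coe]
    exact measure_ball_lt_top.ne
  have hc : 0 < bergmanConst N α := by
    have h1 : 0 < Real.Gamma (N + α + 1) :=
      Real.Gamma_pos_of_pos (by have : (0 : ℝ) ≤ N := N.cast_nonneg; linarith)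
    have h2 : 0 < Real.Gamma (α + 1) := Real.Gamma_pos_of_pos (by linarith)
    unfold bergmanConst
    positivity
  have hpos : ∀ z : UnitBall N,
      0 < 1 - ‖(z : EuclideanSpace ℂ (Fin N))‖ ^ 2 := fun z => by
    have hz : ‖(z : EuclideanSpace ℂ (Fin N))‖ < 1 := mem_ball_zero_iff.1 z.2
    nlinarith [norm_nonneg (z : EuclideanSpace ℂ (Fin N))]
  have h1 : f =ᵐ[normalizedVolume N] 0 := by
    have hm : Measurable fun z : UnitBall N => ENNReal.ofReal
        (bergmanConst N α * (1 - ‖(z : EuclideanSpace ℂ (Fin N))‖ ^ 2) ^ α) := by fun_prop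
    have h' := (ae_withDensity_iff hm).1 h
    filter_upwards [h'] with z hz
    exact hz (ENNReal.ofReal_pos.2 (mul_pos hc (Real.rpow_pos_of_pos (hpos z) α))).ne'
  have h2 : f =ᵐ[ballLebesgue N] 0 := by
    have h0 : normalizedVolume N {z | ¬ f z = (0 : UnitBall N → ℂ) z} = 0 := h1
    rw [normalizedVolume, Measure.smul_apply, smul_eq_mul, mul_eq_zero] at h0
    exact h0.resolve_left (ENNReal.inv_ne_zero.2 hfin)
  have : (ballLebesgue N).IsOpenPosMeasure := by
    refine ⟨fun U hU hne => ?_⟩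
    rw [ballLebesgue, comap_subtype_coe_apply measurableSet_ball]
    exact ((Metric.isOpen_ball.isOpenMap_subtype_val U hU).measure_pos _ (hne.image _)).ne'
  exact (Continuous.ae_eq_iff_eq _ hf continuous_const).1 h2

/-- The weighted Bergman-Orlicz space `A^ψ_α(𝔹_N)`, `α > -1`. It is a type of its own, so that it
carries the Luxemburg norm and not the topology of pointwise convergence. -/
def BergmanOrlicz (N : ℕ) (α : ℝ) (_hα : -1 < α) (ψ : OrliczFunction) : Type :=
  bergmanOrliczSubmodule N α ψ

namespace BergmanOrlicz

variable {N : ℕ} {α : ℝ} {hα : -1 < α} {ψ : OrliczFunction}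

instance : AddCommGroup (BergmanOrlicz N α hα ψ) :=
  inferInstanceAs (AddCommGroup (bergmanOrliczSubmodule N α ψ))

instance : Module ℂ (BergmanOrlicz N α hα ψ) :=
  inferInstanceAs (Module ℂ (bergmanOrliczSubmodule N α ψ))

/-- The function on the ball underlying an element of the Bergman-Orlicz space. -/
def toFun (f : BergmanOrlicz N α hα ψ) : UnitBall N → ℂ :=
  Subtype.val (p := fun g => g ∈ bergmanOrliczSubmodule N α ψ) f

instance : CoeFun (BergmanOrlicz N α hα ψ) (fun _ => UnitBall N → ℂ) := ⟨toFun⟩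

lemma isHolomorphic (f : BergmanOrlicz N α hα ψ) : IsHolomorphic f :=
  (Subtype.property (p := fun g => g ∈ bergmanOrliczSubmodule N α ψ) f).1

lemma memOrlicz (f : BergmanOrlicz N α hα ψ) : MemOrlicz ψ (bergmanMeasure N α) f :=
  (Subtype.property (p := fun g => g ∈ bergmanOrliczSubmodule N α ψ) f).2

instance : Norm (BergmanOrlicz N α hα ψ) :=
  ⟨fun f => luxemburgNorm ψ (bergmanMeasure N α) f⟩

lemma normCore : NormedSpace.Core ℂ (BergmanOrlicz N α hα ψ) where
  norm_nonneg _ := luxemburgNorm_nonneg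
  norm_smul c f := luxemburgNorm_smul c f.memOrlicz
  norm_triangle f g := luxemburgNorm_add_le f.memOrlicz g.memOrlicz
  norm_eq_zero_iff f := by
    refine ⟨fun h => ?_, fun h => ?_⟩
    · exact Subtype.ext (eq_zero_of_ae_eq_zero hα f.isHolomorphic.continuous
        (ae_eq_zero_of_luxemburgNorm_eq_zero f.memOrlicz h))
    · subst h
      exact luxemburgNorm_zero

instance : NormedAddCommGroup (BergmanOrlicz N α hα ψ) := NormedAddCommGroup.ofCore normCore

instance : NormedSpace ℂ (BergmanOrlicz N α hα ψ) := NormedSpace.ofCore normCore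

end BergmanOrlicz

/-- `C_ϕ : f ↦ f ∘ ϕ` is bounded from `A^ψ_α(𝔹_N)` into itself: it maps the space into itself, and
the operator so obtained is a continuous linear operator. -/
def CompositionBounded (N : ℕ) (α : ℝ) (hα : -1 < α) (ψ : OrliczFunction)
    (ϕ : UnitBall N → UnitBall N) : Prop :=
  ∃ T : BergmanOrlicz N α hα ψ →L[ℂ] BergmanOrlicz N α hα ψ, ∀ f z, T f z = f (ϕ z)

/-- `C_ϕ : f ↦ f ∘ ϕ` is compact from `A^ψ_α(𝔹_N)` into itself: it maps the space into itself, and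
the operator so obtained is a compact linear operator. -/
def CompositionCompact (N : ℕ) (α : ℝ) (hα : -1 < α) (ψ : OrliczFunction)
    (ϕ : UnitBall N → UnitBall N) : Prop :=
  ∃ T : BergmanOrlicz N α hα ψ →ₗ[ℂ] BergmanOrlicz N α hα ψ,
    (∀ f z, T f z = f (ϕ z)) ∧ IsCompactOperator T

/-- The non-isotropic distance `d(ζ, ξ) = √|1 - ⟨ζ, ξ⟩|`. Mathlib's inner product is linear in its
second argument; the modulus does not depend on the convention. -/
def nonisotropicDist {N : ℕ} (ζ ξ : EuclideanSpace ℂ (Fin N)) : ℝ :=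
  Real.sqrt ‖1 - inner ℂ ξ ζ‖

/-- The non-isotropic ball `Q(ζ, h)` of the sphere. -/
def sphereBall {N : ℕ} (ζ : EuclideanSpace ℂ (Fin N)) (h : ℝ) :
    Set (EuclideanSpace ℂ (Fin N)) :=
  {ξ | ξ ∈ unitSphere N ∧ nonisotropicDist ζ ξ ^ 2 < h}

/-- The Carleson window `W(ζ, h) = {z ∈ 𝔹_N : 1 - |z| < h, z / |z| ∈ Q(ζ, h)}`. -/
def carlesonWindow {N : ℕ} (ζ : EuclideanSpace ℂ (Fin N)) (h : ℝ) : Set (UnitBall N) :=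
  {z | 1 - ‖(z : EuclideanSpace ℂ (Fin N))‖ < h ∧
    (‖(z : EuclideanSpace ℂ (Fin N))‖⁻¹ : ℂ) • (z : EuclideanSpace ℂ (Fin N)) ∈ sphereBall ζ h}

/-- `ϱ_μ(h) = sup_ξ μ(W(ξ, h))`, the supremum being over the unit sphere. -/
def carlesonRho {N : ℕ} (μ : Measure (UnitBall N)) (h : ℝ) : ℝ≥0∞ :=
  ⨆ ξ ∈ unitSphere N, μ (carlesonWindow ξ h)

/-- `K_{μ,α}(h) = sup_{0 < t ≤ h} ϱ_μ(t) / t^{N+1+α}`. -/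
def carlesonK {N : ℕ} (μ : Measure (UnitBall N)) (α : ℝ) (h : ℝ) : ℝ≥0∞ :=
  ⨆ t ∈ Ioc 0 h, carlesonRho μ t / ENNReal.ofReal (t ^ ((N : ℝ) + 1 + α))

/-- `μ` is an `α`-Bergman-Carleson measure: `K_{μ,α}` is bounded on `(0, 1]`. -/
def IsBergmanCarleson {N : ℕ} (μ : Measure (UnitBall N)) (α : ℝ) : Prop :=
  ∃ C : ℝ≥0, ∀ h ∈ Ioc (0 : ℝ) 1, carlesonK μ α h ≤ C

/-- `μ` is a vanishing `α`-Bergman-Carleson measure: `μ(W(ξ, h)) = o(h^{N+1+α})` as `h → 0⁺`,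
uniformly with respect to `ξ` in the sphere. -/
def IsVanishingBergmanCarleson {N : ℕ} (μ : Measure (UnitBall N)) (α : ℝ) : Prop :=
  Tendsto (fun h : ℝ => carlesonRho μ h / ENNReal.ofReal (h ^ ((N : ℝ) + 1 + α)))
    (𝓝[>] 0) (𝓝 0)

/-- The pull-back measure `μ_ϕ^α(E) = v_α(ϕ⁻¹(E))`. -/
def pullbackMeasure (N : ℕ) (α : ℝ) (ϕ : UnitBall N → UnitBall N) : Measure (UnitBall N) :=
  (bergmanMeasure N α).map ϕ

end

/-! Write `p = N + 1 + α`. Everything rests on one size: a non-isotropic region of scale `h` at the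
sphere, of width about `h` in the complex radial direction and `√h` in the orthogonal ones, has
`v_α`-mass of order at most `h ^ p`. A change of variables turns boundedness and compactness of
`C_ϕ` into statements about `∫ ψ(|f|/c) dμ` with `μ` the pullback measure.

Sufficiency. For holomorphic `f`, the function `ψ(|f|/c)` satisfies the sub-mean-value inequality on
discs, hence on complex ellipsoids adapted to the ball: `(1-|z|)^p ψ(|f(z)|/c)` is at most a
constant times the `v_α`-integral of `ψ(|f|/c)` near `z` (`exists_map_norm_le_lintegral_isNear`).
Integrating in `μ` and exchanging integrals leaves the `μ`-mass of the points near `w`, which lie in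
a Carleson window of size comparable to `1-|w|²`. So a Carleson bound `κ` gives `∫ ψ(|f|/c) dμ ≤ Cκ
∫ ψ(|f|/c) dv_α` with `C` independent of `ψ`, `f` and `c`
(`exists_lintegral_le_of_measure_isNear_le`); by convexity this is a norm bound. In the vanishing
case the constant is arbitrarily small near the sphere, while bounded sequences have locally
uniformly convergent subsequences (Montel and Fatou). The `Δ₂`-condition keeps the modular bounded
at every small scale `ε`, so the boundary part is small and `C_ϕ` is compact.

Necessity. The test functions are `x (h/(1-(1-h)⟨z,e⟩))^k` with `ψ x = h ^ (-p)` and `k > p`.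
Convexity and the integral estimate for the kernel bound their norms (`exists_testFunction`), and on
the window `W(e,h)` their modulus is at least `x/4^k`. Markov's inequality, with `Δ₂` to compare `ψ`
at multiples of `x`, converts a bound on the image norm into a bound on the window
(`exists_measure_carlesonWindow_le`). If `C_ϕ` is compact, the images tend to zero in norm as `h →
0`, because the test functions tend to zero pointwise, and the window bound acquires an arbitrarily
small factor. -/

noncomputable section

/-! ### Elementary properties of Orlicz functions -/

namespace OrliczFunction

lemma continuousOn (ψ : OrliczFunction) : ContinuousOn ψ (Ici 0) := by
  intro x hx
  rcases eq_or_lt_of_le (show (0 : ℝ) ≤ x from hx) with h0 | h0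
  · rw [← h0]; exact ψ.continuousAt_zero'
  · have h := (ψ.strictConvexOn'.convexOn.subset Ioi_subset_Ici_self
      (convex_Ioi 0)).continuousOn isOpen_Ioi
    exact (h.continuousAt (Ioi_mem_nhds h0)).continuousWithinAt

lemma map_mul_le (ψ : OrliczFunction) {x t : ℝ} (hx : 0 ≤ x) (ht : 0 ≤ t) (ht1 : t ≤ 1) :
    ψ (t * x) ≤ t * ψ x := by
  rcases eq_or_lt_of_le ht with h0 | h0
  · simp [← h0, ψ.map_zero']
  · have := ψ.map_div_le hx ((one_le_inv₀ h0).2 ht1)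
    rwa [div_inv_eq_mul, div_inv_eq_mul, mul_comm x, mul_comm (ψ x)] at this

lemma tendsto_atTop (ψ : OrliczFunction) : Tendsto ψ atTop atTop := by
  refine tendsto_atTop_mono' _ ?_ ψ.superlinear'
  filter_upwards [eventually_ge_atTop 1] with x hx
  exact div_le_self (ψ.nonneg' x (by linarith)) hx

lemma exists_map_eq (ψ : OrliczFunction) {A : ℝ} (hA : 0 ≤ A) : ∃ x, 0 ≤ x ∧ ψ x = A := by
  obtain ⟨y, hyA, hy0⟩ := ((ψ.tendsto_atTop.eventually_ge_atTop A).and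
    (eventually_ge_atTop 0)).exists
  have h := intermediate_value_Icc hy0 (ψ.continuousOn.mono Icc_subset_Ici_self)
  obtain ⟨x, hx, h⟩ := h ⟨by rw [ψ.map_zero']; exact hA, hyA⟩
  exact ⟨x, hx.1, h⟩

lemma lt_of_map_lt (ψ : OrliczFunction) {x y : ℝ} (hx : 0 ≤ x) (hy : 0 ≤ y) (h : ψ x < ψ y) :
    x < y := by
  by_contra! hyx
  exact absurd (ψ.monotoneOn hy hx hyx) (not_le.2 h)

lemma DeltaTwo.exists_map_two_pow_mul_le {ψ : OrliczFunction} (h : ψ.DeltaTwo) :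
    ∃ x₀ > (0 : ℝ), ∃ K > (1 : ℝ), ∀ (m : ℕ) (x : ℝ), x₀ ≤ x → ψ (2 ^ m * x) ≤ K ^ m * ψ x := by
  obtain ⟨x₀, hx₀, K, hK, h⟩ := h
  refine ⟨x₀, hx₀, K, hK, fun m => ?_⟩
  induction m with
  | zero => intro x _; simp
  | succ m ih =>
    intro x hx
    have h1 : x₀ ≤ 2 ^ m * x := hx.trans (le_mul_of_one_le_left (hx₀.le.trans hx)
      (one_le_pow₀ (by norm_num)))
    calc ψ (2 ^ (m + 1) * x) = ψ (2 * (2 ^ m * x)) := by ring_nf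
      _ ≤ K * ψ (2 ^ m * x) := h _ h1
      _ ≤ K * (K ^ m * ψ x) := by gcongr; exact ih x hx
      _ = _ := by ring

end OrliczFunction

/-! ### Complex-linear changes of variables and anisotropic scalings -/

section VolumeChange

variable {N : ℕ}

local notation "E" => EuclideanSpace ℂ (Fin N)

/-- The real Jacobian of a complex-linear map is the squared modulus of its complex determinant. No
measurability of `g` is needed because an invertible `A` is a homeomorphism. -/
lemma lintegral_comp_complexLinear (A : E →ₗ[ℂ] E) (hA : LinearMap.det A ≠ 0) (z₀ : E)
    (g : E → ℝ≥0∞) :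
    ∫⁻ z, g z = ENNReal.ofReal (‖LinearMap.det A‖ ^ 2) * ∫⁻ u, g (z₀ + A u) := by
  have hdet : LinearMap.det (A.restrictScalars ℝ) = ‖LinearMap.det A‖ ^ 2 := by
    rw [LinearMap.det_restrictScalars, Algebra.norm_complex_apply, Complex.normSq_eq_norm_sq]
  have hpos : 0 < ‖LinearMap.det A‖ ^ 2 := by positivity
  have hne : LinearMap.det (A.restrictScalars ℝ) ≠ 0 := by rw [hdet]; exact hpos.ne'
  have hmap := Measure.map_linearMap_addHaar_eq_smul_addHaar (volume : Measure E) hne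
  let e := (LinearMap.equivOfDetNeZero A hA).toContinuousLinearEquiv.toHomeomorph
  have he : ∀ u, e u = A u := fun u => rfl
  have h1 : ∫⁻ u, g (z₀ + A u) = ∫⁻ z, g (z₀ + z) ∂(Measure.map A volume) :=
    (e.measurableEmbedding.lintegral_map (fun z => g (z₀ + z))).symm
  have hmap' : Measure.map A (volume : Measure E) =
      ENNReal.ofReal ((‖LinearMap.det A‖ ^ 2)⁻¹) • volume := by
    have : |(LinearMap.det (A.restrictScalars ℝ))⁻¹| = (‖LinearMap.det A‖ ^ 2)⁻¹ := by
      rw [hdet, abs_of_pos (by positivity)]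
    rw [← this]; exact hmap
  rw [h1, hmap', lintegral_smul_measure, lintegral_add_left_eq_self, smul_eq_mul, ← mul_assoc,
    ← ENNReal.ofReal_mul hpos.le, mul_inv_cancel₀ hpos.ne', ENNReal.ofReal_one, one_mul]

/-- The linear map which multiplies the direction `e` by `a` and its orthogonal complement
by `b`. -/
def anisoScaling (e : E) (a b : ℝ) : E →ₗ[ℂ] E :=
  (b : ℂ) • LinearMap.transvection (((a / b - 1 : ℝ) : ℂ) • (innerSL ℂ e).toLinearMap) e

lemma anisoScaling_apply (e : E) {a b : ℝ} (hb : b ≠ 0) (u : E) :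
    anisoScaling e a b u = (b : ℂ) • u + ((a - b : ℝ) * inner ℂ e u : ℂ) • e := by
  have hb' : (b : ℂ) ≠ 0 := by exact_mod_cast hb
  simp only [anisoScaling, LinearMap.smul_apply, LinearMap.transvection.apply, smul_add, smul_smul]
  congr 2
  simp
  field_simp

/-- One eigenvalue is `a` and the other `N - 1` are `b`; writing the product as `b ^ N * (a / b)`
avoids the subtraction in the exponent. -/
lemma det_anisoScaling {e : E} (he : ‖e‖ = 1) {a b : ℝ} :
    LinearMap.det (anisoScaling e a b) = ((b ^ N * (a / b) : ℝ) : ℂ) := by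
  rw [anisoScaling, LinearMap.det_smul, LinearMap.transvection.det]
  simp [he]

lemma inner_anisoScaling {e : E} (he : ‖e‖ = 1) {a b : ℝ} (hb : b ≠ 0) (u : E) :
    inner ℂ e (anisoScaling e a b u) = a * inner ℂ e u := by
  rw [anisoScaling_apply e hb, inner_add_right, inner_smul_right, inner_smul_right,
    inner_self_eq_norm_sq_to_K, he]
  push_cast
  ring

/-- Squared norm of the component of `u` orthogonal to the unit vector `e`. -/
lemma norm_sq_eq_add {e : E} (he : ‖e‖ = 1) (u : E) :
    ‖u‖ ^ 2 = ‖inner ℂ e u‖ ^ 2 + ‖u - (inner ℂ e u : ℂ) • e‖ ^ 2 := by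
  have h := norm_add_sq_eq_norm_sq_add_norm_sq_of_inner_eq_zero (𝕜 := ℂ)
    ((inner ℂ e u : ℂ) • e) (u - (inner ℂ e u : ℂ) • e) (by
      rw [inner_smul_left, inner_sub_right, inner_smul_right, inner_self_eq_norm_sq_to_K, he]
      simp)
  rw [add_sub_cancel, norm_smul, he, mul_one] at h
  simpa [sq] using h

end VolumeChange

/-! ### Sub-mean-value inequalities for `ψ(|g|/c)` -/

section MeanValue

/-- Cauchy's mean value formula bounds `|g 0|` by the circle average of `|g|`; Jensen's inequality
for the increasing convex `ψ` does the rest. -/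
lemma OrliczFunction.map_norm_le_circle (ψ : OrliczFunction) {g : ℂ → ℂ}
    (hg : DiffContOnCl ℂ g (Metric.ball 0 1)) {c : ℝ} (hc : 0 < c) :
    ENNReal.ofReal (2 * Real.pi) * ENNReal.ofReal (ψ (‖g 0‖ / c)) ≤
      ∫⁻ θ in Ioc 0 (2 * Real.pi), ENNReal.ofReal (ψ (‖g (circleMap 0 1 θ)‖ / c)) := by
  have hpi : (0 : ℝ) < 2 * Real.pi := by positivity
  have hcl : ∀ θ, circleMap 0 1 θ ∈ closure (Metric.ball (0 : ℂ) 1) := fun θ => by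
    rw [closure_ball _ one_ne_zero]
    exact circleMap_mem_closedBall _ zero_le_one _
  have hgc : Continuous fun θ => g (circleMap 0 1 θ) :=
    hg.continuousOn.comp_continuous (continuous_circleMap 0 1) hcl
  have hu : Continuous fun θ => ‖g (circleMap 0 1 θ)‖ / c := hgc.norm.div_const c
  have hu0 : ∀ θ, 0 ≤ ‖g (circleMap 0 1 θ)‖ / c := fun θ => by positivity
  have hψ : Continuous fun θ => ψ (‖g (circleMap 0 1 θ)‖ / c) :=
    ψ.continuousOn.comp_continuous hu hu0
  have hint : ∀ {v : ℝ → ℝ}, Continuous v →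
      Integrable v (volume.restrict (Ioc 0 (2 * Real.pi))) := fun hv =>
    (hv.integrableOn_Icc).mono_set Ioc_subset_Icc_self
  have hne : NeZero (volume.restrict (Ioc 0 (2 * Real.pi))) := ⟨by
    rw [Ne, Measure.restrict_eq_zero, Real.volume_Ioc]; simp [Real.pi_pos]⟩
  have hJ := ψ.strictConvexOn'.convexOn.map_average_le ψ.continuousOn isClosed_Ici
    (μ := volume.restrict (Ioc 0 (2 * Real.pi))) (f := fun θ => ‖g (circleMap 0 1 θ)‖ / c)
    (Eventually.of_forall fun θ => hu0 θ) (hint hu) (hint hψ)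
  have hvol : (volume.restrict (Ioc 0 (2 * Real.pi))).real univ = 2 * Real.pi := by
    simp [Measure.real, Real.pi_pos.le]
  rw [average_eq, average_eq, hvol, smul_eq_mul, smul_eq_mul] at hJ
  have hmv : ‖g 0‖ ≤ (2 * Real.pi)⁻¹ * ∫ θ in Ioc 0 (2 * Real.pi), ‖g (circleMap 0 1 θ)‖ := by
    have h := DiffContOnCl.circleAverage (f := g) (c := 0) (R := 1) (by simpa using hg)
    rw [Real.circleAverage, intervalIntegral.integral_of_le hpi.le] at h
    rw [← h, norm_smul, Real.norm_of_nonneg (by positivity)]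
    gcongr
    exact norm_integral_le_integral_norm _
  have hle : ψ (‖g 0‖ / c) ≤
      (2 * Real.pi)⁻¹ * ∫ θ in Ioc 0 (2 * Real.pi), ψ (‖g (circleMap 0 1 θ)‖ / c) := by
    refine le_trans (ψ.monotoneOn (mem_Ici.2 (by positivity)) (mem_Ici.2 ?_) ?_) hJ
    · exact mul_nonneg (by positivity) (integral_nonneg fun θ => hu0 θ)
    · rw [integral_div, ← mul_div_assoc]
      gcongr
  rw [← ofReal_integral_eq_lintegral_ofReal (hint hψ)
    (Eventually.of_forall fun θ => ψ.nonneg' _ (hu0 θ)), ← ENNReal.ofReal_mul hpi.le]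
  apply ENNReal.ofReal_le_ofReal
  rwa [← le_inv_mul_iff₀ hpi]

variable {N : ℕ}

local notation "E" => EuclideanSpace ℂ (Fin N)

lemma lintegral_ball_comp_smul {t : ℂ} (ht : ‖t‖ = 1) (g : E → ℝ≥0∞) :
    ∫⁻ u in Metric.ball (0 : E) 1, g (t • u) = ∫⁻ u in Metric.ball (0 : E) 1, g u := by
  have hdet : LinearMap.det (t • (LinearMap.id : E →ₗ[ℂ] E)) = t ^ N := by
    simp [LinearMap.det_smul]
  have ht0 : t ≠ 0 := norm_ne_zero_iff.1 (by rw [ht]; exact one_ne_zero)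
  have h := lintegral_comp_complexLinear (t • (LinearMap.id : E →ₗ[ℂ] E))
    (by rw [hdet]; exact pow_ne_zero _ ht0) 0 ((Metric.ball (0 : E) 1).indicator g)
  rw [hdet, norm_pow, ht, one_pow, one_pow, ENNReal.ofReal_one, one_mul,
    lintegral_indicator measurableSet_ball] at h
  rw [h, ← lintegral_indicator measurableSet_ball]
  refine lintegral_congr fun u => ?_
  simp only [indicator, mem_ball_zero_iff, LinearMap.smul_apply, LinearMap.id_apply, zero_add,
    norm_smul, ht, one_mul]

/-- Mean value inequality for `ψ(|G|/c)` over the unit ball. -/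
lemma OrliczFunction.map_norm_le_ball (ψ : OrliczFunction) {G : E → ℂ}
    (hG : DifferentiableOn ℂ G (Metric.ball 0 1)) {c : ℝ} (hc : 0 < c) :
    volume (Metric.ball (0 : E) 1) * ENNReal.ofReal (ψ (‖G 0‖ / c)) ≤
      ∫⁻ u in Metric.ball (0 : E) 1, ENNReal.ofReal (ψ (‖G u‖ / c)) := by
  have hpi : (0 : ℝ) < 2 * Real.pi := by positivity
  -- The slice `t ↦ G (t • u)` is holomorphic on a neighbourhood of the closed unit disc because
  -- `‖u‖ < 1`.
  have hcirc : ∀ u ∈ Metric.ball (0 : E) 1,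
      ENNReal.ofReal (2 * Real.pi) * ENNReal.ofReal (ψ (‖G 0‖ / c)) ≤
      ∫⁻ θ in Ioc 0 (2 * Real.pi), ENNReal.ofReal (ψ (‖G (circleMap 0 1 θ • u)‖ / c)) := by
    intro u hu
    have hu' : ‖u‖ < 1 := mem_ball_zero_iff.1 hu
    have hmaps : ∀ t ∈ closure (Metric.ball (0 : ℂ) 1), t • u ∈ Metric.ball (0 : E) 1 := by
      intro t ht
      rw [closure_ball _ one_ne_zero, mem_closedBall_zero_iff] at ht
      rw [mem_ball_zero_iff, norm_smul]
      nlinarith [norm_nonneg u]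
    have hd : DifferentiableOn ℂ (fun t : ℂ => G (t • u)) (closure (Metric.ball 0 1)) :=
      hG.comp (by fun_prop) hmaps
    have := ψ.map_norm_le_circle hd.diffContOnCl hc
    simpa using this
  have hcont : ContinuousOn (fun q : E × ℝ => G (circleMap 0 1 q.2 • q.1))
      (Metric.ball 0 1 ×ˢ Ioc 0 (2 * Real.pi)) := by
    refine hG.continuousOn.comp (by fun_prop) ?_
    rintro ⟨u, θ⟩ ⟨hu, -⟩
    simpa [norm_smul] using hu
  have hmeas : AEMeasurable (fun q : E × ℝ =>
      ENNReal.ofReal (ψ (‖G (circleMap 0 1 q.2 • q.1)‖ / c)))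
      ((volume.restrict (Metric.ball 0 1)).prod (volume.restrict (Ioc 0 (2 * Real.pi)))) := by
    rw [Measure.prod_restrict]
    refine ψ.measurable_comp_norm ?_ c hc
    exact hcont.aemeasurable (measurableSet_ball.prod measurableSet_Ioc)
  -- Average the slice inequalities over `u` and exchange the integrals: by rotation invariance of
  -- the ball, the integral over `u` no longer depends on `θ`.
  have h1 : ENNReal.ofReal (2 * Real.pi) *
      (volume (Metric.ball (0 : E) 1) * ENNReal.ofReal (ψ (‖G 0‖ / c))) ≤
      ENNReal.ofReal (2 * Real.pi) *
        ∫⁻ u in Metric.ball (0 : E) 1, ENNReal.ofReal (ψ (‖G u‖ / c)) := by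
    calc _ = ∫⁻ u in Metric.ball (0 : E) 1,
          ENNReal.ofReal (2 * Real.pi) * ENNReal.ofReal (ψ (‖G 0‖ / c)) := by
          rw [setLIntegral_const]; ring
      _ ≤ ∫⁻ u in Metric.ball (0 : E) 1, ∫⁻ θ in Ioc 0 (2 * Real.pi),
          ENNReal.ofReal (ψ (‖G (circleMap 0 1 θ • u)‖ / c)) :=
          setLIntegral_mono' measurableSet_ball hcirc
      _ = ∫⁻ θ in Ioc 0 (2 * Real.pi), ∫⁻ u in Metric.ball (0 : E) 1,
          ENNReal.ofReal (ψ (‖G (circleMap 0 1 θ • u)‖ / c)) :=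
          lintegral_lintegral_swap hmeas
      _ = ∫⁻ θ in Ioc 0 (2 * Real.pi), ∫⁻ u in Metric.ball (0 : E) 1,
          ENNReal.ofReal (ψ (‖G u‖ / c)) := by
          refine lintegral_congr fun θ => ?_
          exact lintegral_ball_comp_smul (by simp) fun u => ENNReal.ofReal (ψ (‖G u‖ / c))
      _ = _ := by
          rw [setLIntegral_const, Real.volume_Ioc, sub_zero, mul_comm]
  exact (ENNReal.mul_le_mul_iff_right (by simp [Real.pi_pos]) ENNReal.ofReal_ne_top).1 h1

end MeanValue

/-! ### The measure `v_α` and the mean value inequality at non-isotropic scale -/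

section BergmanMeasure

variable {N : ℕ}

local notation "E" => EuclideanSpace ℂ (Fin N)

lemma bergmanConst_pos (N : ℕ) {α : ℝ} (hα : -1 < α) : 0 < bergmanConst N α := by
  have h1 : 0 < Real.Gamma (N + α + 1) :=
    Real.Gamma_pos_of_pos (by have : (0 : ℝ) ≤ N := N.cast_nonneg; linarith)
  have h2 : 0 < Real.Gamma (α + 1) := Real.Gamma_pos_of_pos (by linarith)
  unfold bergmanConst
  positivity

lemma UnitBall.norm_lt_one (z : UnitBall N) : ‖(z : E)‖ < 1 := mem_ball_zero_iff.1 z.2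

lemma one_sub_norm_sq_pos {z : E} (hz : ‖z‖ < 1) : 0 < 1 - ‖z‖ ^ 2 := by
  nlinarith [norm_nonneg z]

/-- The total factor between the weighted Lebesgue measure and `bergmanMeasure`. -/
def bergmanFactor (N : ℕ) (α : ℝ) : ℝ≥0∞ :=
  (ballLebesgue N univ)⁻¹ * ENNReal.ofReal (bergmanConst N α)

lemma ballLebesgue_univ : ballLebesgue N univ = volume (Metric.ball (0 : E) 1) := by
  rw [ballLebesgue, comap_subtype_coe_apply measurableSet_ball, image_univ, Subtype.range_coe]

lemma bergmanFactor_ne_zero {α : ℝ} (hα : -1 < α) : bergmanFactor N α ≠ 0 := by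
  rw [bergmanFactor, ballLebesgue_univ]
  exact mul_ne_zero (ENNReal.inv_ne_zero.2 measure_ball_lt_top.ne)
    (ENNReal.ofReal_pos.2 (bergmanConst_pos N hα)).ne'

lemma bergmanFactor_ne_top (α : ℝ) : bergmanFactor N α ≠ ∞ := by
  rw [bergmanFactor, ballLebesgue_univ]
  exact ENNReal.mul_ne_top (ENNReal.inv_ne_top.2 (Metric.measure_ball_pos _ _ one_pos).ne')
    ENNReal.ofReal_ne_top

lemma lintegral_bergmanMeasure {α : ℝ} (hα : -1 < α) (g : E → ℝ≥0∞) :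
    ∫⁻ z : UnitBall N, g z ∂(bergmanMeasure N α) = bergmanFactor N α *
      ∫⁻ z in Metric.ball (0 : E) 1, ENNReal.ofReal ((1 - ‖z‖ ^ 2) ^ α) * g z := by
  have hm : Measurable fun z : UnitBall N => ENNReal.ofReal
      (bergmanConst N α * (1 - ‖(z : E)‖ ^ 2) ^ α) := by fun_prop
  rw [bergmanMeasure, lintegral_withDensity_eq_lintegral_mul_non_measurable _ hm
    (Eventually.of_forall fun _ => ENNReal.ofReal_lt_top), normalizedVolume,
    lintegral_smul_measure, bergmanFactor, smul_eq_mul, mul_assoc]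
  congr 1
  rw [← lintegral_const_mul' _ _ ENNReal.ofReal_ne_top, ballLebesgue,
    ← lintegral_subtype_comap measurableSet_ball]
  refine lintegral_congr fun z => ?_
  rw [Pi.mul_apply, ENNReal.ofReal_mul (bergmanConst_pos N hα).le, mul_assoc]

/-- In polar coordinates the weight factors as `(1+y)^α (1-y)^α`; the first factor is at most
`2^|α|` on `(0,1)` and the second is integrable since `α > -1`. -/
lemma isFiniteMeasure_bergmanMeasure (hN : 1 ≤ N) {α : ℝ} (hα : -1 < α) :
    IsFiniteMeasure (bergmanMeasure N α) := by
  have : Nonempty (Fin N) := ⟨⟨0, hN⟩⟩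
  have hdim : 1 ≤ Module.finrank ℝ E := Module.finrank_pos
  refine ⟨?_⟩
  have h := lintegral_bergmanMeasure (N := N) hα (fun _ => 1)
  rw [lintegral_one] at h
  rw [h]
  refine ENNReal.mul_lt_top (bergmanFactor_ne_top α).lt_top ?_
  have hint : IntegrableOn (fun z : E => (1 - ‖z‖ ^ 2) ^ α) (Metric.ball 0 1) := by
    rw [integrableOn_fun_norm_addHaar (μ := (volume : Measure E)) (f := fun y => (1 - y ^ 2) ^ α)]
    have h1 : IntegrableOn (fun y : ℝ => (1 - y) ^ α) (Ioo 0 1) := by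
      have h := (intervalIntegral.intervalIntegrable_rpow' (a := 0) (b := 1) hα)
      have h := h.comp_sub_left 1
      simp only [sub_zero, sub_self] at h
      exact (intervalIntegrable_iff_integrableOn_Ioo_of_le zero_le_one).1 h.symm
    refine (h1.const_mul ((2 : ℝ) ^ |α|)).mono' ?_ ?_
    · refine Measurable.aestronglyMeasurable ?_
      fun_prop
    · refine (ae_restrict_iff' measurableSet_Ioo).2 (Eventually.of_forall fun y hy => ?_)
      have hy1 : 0 < 1 - y := by linarith [hy.2]
      have hy2 : (1 - y ^ 2) ^ α = (1 + y) ^ α * (1 - y) ^ α := by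
        rw [← Real.mul_rpow (by linarith [hy.1]) hy1.le]; ring_nf
      have hy3 : (1 + y) ^ α ≤ 2 ^ |α| :=
        (Real.rpow_le_rpow_of_exponent_le (by linarith [hy.1]) (le_abs_self α)).trans
          (Real.rpow_le_rpow (by linarith [hy.1]) (by linarith [hy.2]) (abs_nonneg α))
      have hy4 : y ^ (Module.finrank ℝ E - 1) ≤ 1 := pow_le_one₀ hy.1.le hy.2.le
      have hy5 : 0 ≤ y ^ (Module.finrank ℝ E - 1) := pow_nonneg hy.1.le _
      have hy6 : 0 ≤ (1 + y) ^ α := Real.rpow_nonneg (by linarith [hy.1]) _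
      have hy7 : 0 ≤ (1 - y) ^ α := Real.rpow_nonneg hy1.le _
      rw [smul_eq_mul, hy2, Real.norm_of_nonneg (by positivity)]
      calc _ ≤ 1 * ((1 + y) ^ α * (1 - y) ^ α) := by gcongr
        _ ≤ _ := by rw [one_mul]; gcongr
  have h2 := hint.lintegral_lt_top
  simpa using h2

/-- Points `w` lying in a non-isotropic neighbourhood of `z` of size comparable to
`1 - |z|`. -/
def IsNear (z w : E) : Prop :=
  ‖1 - inner ℂ z w‖ < 3 * (1 - ‖z‖) ∧ 1 - ‖z‖ < 5 * (1 - ‖w‖ ^ 2)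

/-- Since `1-‖w‖ ≤ |1-⟨z,w⟩| < 3(1-‖z‖)`, the factor `1+‖w‖ < 2` yields the constant 6. Together
with the second clause of `IsNear`, this makes the two distances to the sphere comparable. -/
lemma IsNear.one_sub_norm_sq_lt {z w : E} (hz : ‖z‖ < 1) (hw : ‖w‖ < 1) (h : IsNear z w) :
    1 - ‖w‖ ^ 2 < 6 * (1 - ‖z‖) := by
  have h1 : 1 - ‖w‖ ≤ ‖1 - inner ℂ z w‖ := by
    have h2 := norm_sub_norm_le (1 : ℂ) (inner ℂ z w)
    have h3 := norm_inner_le_norm (𝕜 := ℂ) z w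
    rw [norm_one] at h2
    nlinarith [norm_nonneg w]
  nlinarith [h.1, norm_nonneg w]

/-- The ellipsoid centred at `(1-r)e` may extend to order `√r` across `e`, because an orthogonal
displacement enters `‖w‖²` only through its square, here at most `r/16`. Along `e` the displacement
is at most `r/4`, so `|⟨e,w⟩|` lies between `1-5r/4` and `1-3r/4`. -/
lemma isNear_anisoScaling {e : E} (he : ‖e‖ = 1) {r : ℝ} (hr : 0 < r) (hr1 : r ≤ 1) {u : E}
    (hu : ‖u‖ < 1) :
    let w := ((1 - r : ℝ) : ℂ) • e + anisoScaling e (r / 4) (√r / 4) u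
    ‖1 - inner ℂ (((1 - r : ℝ) : ℂ) • e) w‖ < 3 * r ∧ r / 4 ≤ 1 - ‖w‖ ^ 2 ∧
      1 - ‖w‖ ^ 2 ≤ 4 * r := by
  intro w
  have hb : √r / 4 ≠ 0 := by positivity
  set a : ℂ := inner ℂ e u with ha
  have hin : inner ℂ e w = ((1 - r : ℝ) : ℂ) + (r / 4 : ℝ) * a := by
    rw [inner_add_right, inner_anisoScaling he hb, inner_smul_right, inner_self_eq_norm_sq_to_K, he]
    simp [ha]
  have hperp : w - (inner ℂ e w : ℂ) • e = ((√r / 4 : ℝ) : ℂ) • (u - a • e) := by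
    rw [hin, show w = _ + _ from rfl, anisoScaling_apply e hb, ← ha]
    push_cast
    module
  have hw := norm_sq_eq_add he w
  rw [hperp, norm_smul, mul_pow, Complex.norm_real, Real.norm_of_nonneg (by positivity), div_pow,
    Real.sq_sqrt hr.le, hin] at hw
  have hu2 := norm_sq_eq_add he u
  rw [← ha] at hu2
  set b : ℝ := ‖u - a • e‖ with hbdef
  have ha1 : ‖a‖ ≤ 1 := by
    have h := norm_inner_le_norm (𝕜 := ℂ) e u
    rw [he, one_mul] at h
    exact h.trans hu.le
  have hb1 : b ^ 2 ≤ 1 := by nlinarith [norm_nonneg u, norm_nonneg a]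
  have hna : ‖((r / 4 : ℝ) : ℂ) * a‖ = r / 4 * ‖a‖ := by
    rw [norm_mul, Complex.norm_real, Real.norm_of_nonneg (by positivity)]
  have hn1 : ‖((1 - r : ℝ) : ℂ)‖ = 1 - r := by
    rw [Complex.norm_real, Real.norm_of_nonneg (by linarith)]
  have hup : ‖((1 - r : ℝ) : ℂ) + (r / 4 : ℝ) * a‖ ≤ (1 - r) + r / 4 := by
    refine (norm_add_le _ _).trans ?_
    rw [hna, hn1]
    nlinarith
  have hlow : (1 - r) - r / 4 ≤ ‖((1 - r : ℝ) : ℂ) + (r / 4 : ℝ) * a‖ := by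
    have h := norm_sub_le_norm_add ((1 - r : ℝ) : ℂ) ((r / 4 : ℝ) * a)
    rw [hna, hn1] at h
    nlinarith
  set X := ‖((1 - r : ℝ) : ℂ) + (r / 4 : ℝ) * a‖ with hX
  have hX0 : 0 ≤ X := norm_nonneg _
  refine ⟨?_, ?_, ?_⟩
  · rw [inner_smul_left, hin, Complex.conj_ofReal]
    have : (1 : ℂ) - ((1 - r : ℝ) : ℂ) * (((1 - r : ℝ) : ℂ) + (r / 4 : ℝ) * a) =
        ((2 * r - r ^ 2 : ℝ) : ℂ) - ((1 - r : ℝ) : ℂ) * ((r / 4 : ℝ) * a) := by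
      push_cast; ring
    rw [this]
    refine (norm_sub_le _ _).trans_lt ?_
    rw [norm_mul, hna, hn1, Complex.norm_real, Real.norm_of_nonneg (by nlinarith)]
    have : (1 - r) * (r / 4 * ‖a‖) ≤ r / 4 := by
      have h1 : r / 4 * ‖a‖ ≤ r / 4 := by nlinarith
      have h2 : 0 ≤ r / 4 * ‖a‖ := by positivity
      nlinarith
    nlinarith
  · nlinarith
  · have : 0 ≤ r / 4 ^ 2 * b ^ 2 := by positivity
    -- When `1 - 5r/4` is negative its square gives no lower bound for `X²`, but then `4r > 1` and
    -- the claim is immediate.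
    rcases le_or_gt 0 ((1 - r) - r / 4) with h | h
    · nlinarith
    · nlinarith [sq_nonneg X]

lemma exists_unit_smul_eq (hN : 1 ≤ N) (z : E) : ∃ e : E, ‖e‖ = 1 ∧ z = (‖z‖ : ℂ) • e := by
  rcases eq_or_ne z 0 with rfl | hz
  · exact ⟨EuclideanSpace.single ⟨0, hN⟩ 1, by simp, by simp⟩
  · have hz' : (‖z‖ : ℂ) ≠ 0 := by exact_mod_cast norm_ne_zero_iff.2 hz
    exact ⟨(‖z‖ : ℂ)⁻¹ • z, by
      rw [norm_smul, norm_inv, Complex.norm_real, norm_norm,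
        inv_mul_cancel₀ (norm_ne_zero_iff.2 hz)], by
      rw [smul_smul, mul_inv_cancel₀ hz', one_smul]⟩

lemma rpow_le_of_comparable {x y A α : ℝ} (hx : 0 < x) (hy : 0 < y) (hA : 1 ≤ A) (h1 : x ≤ A * y)
    (h2 : y ≤ A * x) : x ^ α ≤ A ^ |α| * y ^ α := by
  have hA0 : 0 < A := by linarith
  rcases le_or_gt 0 α with h | h
  · rw [abs_of_nonneg h, ← Real.mul_rpow hA0.le hy.le]
    exact Real.rpow_le_rpow hx.le h1 h
  · rw [abs_of_neg h, Real.rpow_neg hA0.le, inv_mul_eq_div, le_div_iff₀ (by positivity), mul_comm,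
      ← Real.mul_rpow hA0.le hx.le]
    exact Real.rpow_le_rpow_of_nonpos hy h2 h.le

/-- Mean value inequality for `ψ(|F|/c)` over non-isotropic neighbourhoods. -/
lemma exists_map_norm_le_lintegral_isNear (hN : 1 ≤ N) {α : ℝ} (hα : -1 < α) :
    ∃ C : ℝ≥0∞, C ≠ ∞ ∧ ∀ (ψ : OrliczFunction) (F : E → ℂ),
      DifferentiableOn ℂ F (Metric.ball 0 1) → ∀ c : ℝ, 0 < c → ∀ z : UnitBall N,
      ENNReal.ofReal ((1 - ‖(z : E)‖) ^ ((N : ℝ) + 1 + α)) * ENNReal.ofReal (ψ (‖F z‖ / c)) ≤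
        C * ∫⁻ w : UnitBall N, {w : E | IsNear (z : E) w}.indicator
          (fun w => ENNReal.ofReal (ψ (‖F w‖ / c))) w ∂(bergmanMeasure N α) := by
  set V := volume (Metric.ball (0 : E) 1) with hV
  have hV0 : V ≠ 0 := (Metric.measure_ball_pos _ _ one_pos).ne'
  have hVt : V ≠ ∞ := measure_ball_lt_top.ne
  -- `4^|α|` pays for replacing `r^α` by the weight on the ellipsoid, and `16^N` is the constant in
  -- its Jacobian `r^(N+1)/16^N`.
  refine ⟨V⁻¹ * (ENNReal.ofReal (4 ^ |α| * 16 ^ N) * (bergmanFactor N α)⁻¹), ?_, ?_⟩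
  · exact ENNReal.mul_ne_top (ENNReal.inv_ne_top.2 hV0) (ENNReal.mul_ne_top ENNReal.ofReal_ne_top
      (ENNReal.inv_ne_top.2 (bergmanFactor_ne_zero hα)))
  intro ψ F hF c hc z
  rw [lintegral_bergmanMeasure hα, mul_assoc, mul_assoc, ← mul_assoc (bergmanFactor N α)⁻¹,
    ENNReal.inv_mul_cancel (bergmanFactor_ne_zero hα) (bergmanFactor_ne_top α), one_mul,
    ← ENNReal.mul_le_iff_le_inv hV0 hVt]
  obtain ⟨e, he, hze⟩ := exists_unit_smul_eq hN (z : E)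
  have hz1 : ‖(z : E)‖ < 1 := z.norm_lt_one
  set r := 1 - ‖(z : E)‖ with hr
  have hr0 : 0 < r := by linarith
  have hr1 : r ≤ 1 := by linarith [norm_nonneg (z : E)]
  have hze' : (z : E) = ((1 - r : ℝ) : ℂ) • e := by rw [hr, sub_sub_cancel]; exact hze
  have hb : √r / 4 ≠ 0 := by positivity
  set L := anisoScaling e (r / 4) (√r / 4) with hL
  -- The image of the unit ball under `u ↦ z + L u` stays in the ball, consists of points near `z`,
  -- and has weight comparable to `r^α`.
  have hnear : ∀ u ∈ Metric.ball (0 : E) 1, IsNear (z : E) (z + L u) ∧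
      ‖(z : E) + L u‖ < 1 ∧ r ^ α ≤ 4 ^ |α| * (1 - ‖(z : E) + L u‖ ^ 2) ^ α := by
    intro u hu
    have h := isNear_anisoScaling he hr0 hr1 (mem_ball_zero_iff.1 hu)
    simp only [← hL, ← hze'] at h
    obtain ⟨h1, h2, h3⟩ := h
    refine ⟨⟨h1, by linarith⟩, ?_, rpow_le_of_comparable hr0 (by linarith) (by norm_num)
      (by linarith) (by linarith)⟩
    nlinarith [norm_nonneg ((z : E) + L u)]
  have hdet : LinearMap.det L = (((√r / 4) ^ N * ((r / 4) / (√r / 4)) : ℝ) : ℂ) :=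
    det_anisoScaling he
  have hdet2 : ‖LinearMap.det L‖ ^ 2 = r ^ (N + 1) / 16 ^ N := by
    rw [hdet, Complex.norm_real, Real.norm_of_nonneg (by positivity)]
    have h1 : √r ^ 2 = r := Real.sq_sqrt hr0.le
    have h2 : (r / 4) / (√r / 4) = √r := by
      rw [div_div_div_cancel_right₀ (by norm_num), Real.div_sqrt]
    rw [h2, mul_pow, ← pow_mul, mul_comm N 2, pow_mul, div_pow, h1, div_pow, pow_succ]
    norm_num
    ring
  have hdet0 : LinearMap.det L ≠ 0 := by
    intro h
    rw [h, norm_zero] at hdet2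
    have : 0 < r ^ (N + 1) / 16 ^ N := by positivity
    norm_num at hdet2
    linarith
  have hG : DifferentiableOn ℂ (fun u => F (z + L u)) (Metric.ball 0 1) := by
    refine hF.comp ?_ fun u hu => mem_ball_zero_iff.2 (hnear u hu).2.1
    exact ((LinearMap.toContinuousLinearMap L).differentiable.const_add (z : E)).differentiableOn
  have hmv := ψ.map_norm_le_ball hG hc
  simp only [map_zero, add_zero] at hmv
  set g : E → ℝ≥0∞ := (Metric.ball (0 : E) 1).indicator fun w =>
    ENNReal.ofReal ((1 - ‖w‖ ^ 2) ^ α) * {w : E | IsNear (z : E) w}.indicator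
          (fun w => ENNReal.ofReal (ψ (‖F w‖ / c))) w with hg
  have hcv := lintegral_comp_complexLinear L hdet0 (z : E) g
  rw [hg, lintegral_indicator measurableSet_ball, ← hg, hdet2] at hcv
  rw [hcv]
  have hrp : r ^ ((N : ℝ) + 1 + α) = r ^ (N + 1) * r ^ α := by
    rw [Real.rpow_add hr0, ← Real.rpow_natCast]; push_cast; rfl
  -- The power `r^(N+1+α)` splits: `r^(N+1)` is absorbed by the Jacobian and `r^α` by the weight.
  calc V * (ENNReal.ofReal (r ^ ((N : ℝ) + 1 + α)) * ENNReal.ofReal (ψ (‖F z‖ / c)))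
      = ENNReal.ofReal (r ^ ((N : ℝ) + 1 + α)) * (V * ENNReal.ofReal (ψ (‖F z‖ / c))) := by ring
    _ ≤ ENNReal.ofReal (r ^ ((N : ℝ) + 1 + α)) *
        ∫⁻ u in Metric.ball (0 : E) 1, ENNReal.ofReal (ψ (‖F (z + L u)‖ / c)) := by gcongr
    _ = ENNReal.ofReal (r ^ (N + 1)) *
        ∫⁻ u in Metric.ball (0 : E) 1,
          ENNReal.ofReal (r ^ α) * ENNReal.ofReal (ψ (‖F (z + L u)‖ / c)) := by
        rw [lintegral_const_mul' _ _ ENNReal.ofReal_ne_top, ← mul_assoc,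
          ← ENNReal.ofReal_mul (by positivity), hrp]
    _ ≤ ENNReal.ofReal (r ^ (N + 1)) *
        ∫⁻ u in Metric.ball (0 : E) 1, ENNReal.ofReal (4 ^ |α|) * g (z + L u) := by
        refine mul_le_mul_right ?_ _
        refine setLIntegral_mono' measurableSet_ball fun u hu => ?_
        obtain ⟨h1, h2, h3⟩ := hnear u hu
        rw [hg, indicator_of_mem (mem_ball_zero_iff.2 h2), indicator_of_mem (by exact h1),
          ← mul_assoc, ← ENNReal.ofReal_mul (p := 4 ^ |α|) (by positivity)]
        exact mul_le_mul_left (ENNReal.ofReal_le_ofReal h3) _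
    _ ≤ ENNReal.ofReal (r ^ (N + 1)) * (ENNReal.ofReal (4 ^ |α|) * ∫⁻ u, g (z + L u)) := by
        rw [lintegral_const_mul' _ _ ENNReal.ofReal_ne_top]
        exact mul_le_mul_right (mul_le_mul_right (setLIntegral_le_lintegral _ _) _) _
    _ = _ := by
        rw [← mul_assoc, ← mul_assoc, ← ENNReal.ofReal_mul (by positivity),
          ← ENNReal.ofReal_mul (by positivity)]
        congr 2
        field_simp

end BergmanMeasure

/-! ### The `v_α`-mass of non-isotropic regions at the sphere -/

lemma lintegral_Ioc_rpow {α t : ℝ} (hα : -1 < α) (ht : 0 < t) :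
    ∫⁻ x in Ioc 0 t, ENNReal.ofReal (x ^ α) = ENNReal.ofReal (t ^ (α + 1) / (α + 1)) := by
  have h := integral_rpow (a := 0) (b := t) (Or.inl hα)
  rw [intervalIntegral.integral_of_le ht.le, Real.zero_rpow (by linarith), sub_zero] at h
  rw [← h, ofReal_integral_eq_lintegral_ofReal]
  · exact (intervalIntegral.intervalIntegrable_rpow' hα).1
  · exact (ae_restrict_iff' measurableSet_Ioc).2
      (Eventually.of_forall fun x hx => Real.rpow_nonneg hx.1.le _)

section NonisotropicVolume

variable {N : ℕ}

local notation "E" => EuclideanSpace ℂ (Fin N)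

/-- By Pythagoras the orthogonal part is at most `1 - |⟨e,z⟩|² ≤ 1 - (1-t)² ≤ 2t`. -/
lemma norm_sub_inner_smul_sq_le {e z : E} (he : ‖e‖ = 1) (hz : ‖z‖ < 1) {t : ℝ} (ht : t ≤ 1)
    (h : ‖1 - inner ℂ e z‖ < t) : ‖z - (inner ℂ e z : ℂ) • e‖ ^ 2 ≤ 2 * t := by
  have h1 := norm_sq_eq_add he z
  have h2 := norm_sub_norm_le (1 : ℂ) (inner ℂ e z)
  rw [norm_one] at h2
  have h3 : (1 - t) ^ 2 ≤ ‖inner ℂ e z‖ ^ 2 := by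
    apply pow_le_pow_left₀ <;> linarith
  have h4 : ‖z‖ ^ 2 ≤ 1 := pow_le_one₀ (norm_nonneg z) hz.le
  nlinarith [sq_nonneg t]

lemma measurableSet_nonisotropic (e : E) (a b : ℝ) : MeasurableSet
    {z : E | ‖1 - inner ℂ e z‖ < a ∧ ‖z - (inner ℂ e z : ℂ) • e‖ ^ 2 ≤ b} := by
  have h1 : IsOpen {z : E | ‖1 - inner ℂ e z‖ < a} := isOpen_lt (by fun_prop) continuous_const
  have h2 : IsClosed {z : E | ‖z - (inner ℂ e z : ℂ) • e‖ ^ 2 ≤ b} :=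
    isClosed_le (by fun_prop) continuous_const
  exact h1.measurableSet.inter h2.measurableSet

/-- The anisotropic map with factors `2t` along `e` and `2√t` across it, centred at `e`, pulls the
region back into a fixed ball; its Jacobian is `4^N t^(N+1)`. -/
lemma volume_nonisotropic_le {e : E} (he : ‖e‖ = 1) {t : ℝ} (ht : 0 < t) :
    volume {z : E | ‖1 - inner ℂ e z‖ < 2 * t ∧ ‖z - (inner ℂ e z : ℂ) • e‖ ^ 2 ≤ 2 * t} ≤
      ENNReal.ofReal (4 ^ N * t ^ (N + 1)) * volume (Metric.ball (0 : E) 2) := by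
  set S := {z : E | ‖1 - inner ℂ e z‖ < 2 * t ∧ ‖z - (inner ℂ e z : ℂ) • e‖ ^ 2 ≤ 2 * t} with hS
  have hSm : MeasurableSet S := measurableSet_nonisotropic e _ _
  have hb : 2 * √t ≠ 0 := by positivity
  set L := anisoScaling e (2 * t) (2 * √t) with hL
  have hdet2 : ‖LinearMap.det L‖ ^ 2 = 4 ^ N * t ^ (N + 1) := by
    rw [hL, det_anisoScaling he, Complex.norm_real, Real.norm_of_nonneg (by positivity)]
    have h1 : √t ^ 2 = t := Real.sq_sqrt ht.le
    have h2 : (2 * t) / (2 * √t) = √t := by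
      rw [mul_div_mul_left _ _ (by norm_num), Real.div_sqrt]
    rw [h2, mul_pow, ← pow_mul, mul_comm N 2, pow_mul, mul_pow, h1, mul_pow, pow_succ]
    norm_num
    ring
  have hdet0 : LinearMap.det L ≠ 0 := by
    intro h
    rw [h, norm_zero] at hdet2
    have : 0 < 4 ^ N * t ^ (N + 1) := by positivity
    norm_num at hdet2
    linarith
  rw [← lintegral_indicator_one hSm, lintegral_comp_complexLinear L hdet0 e, hdet2,
    ← lintegral_indicator_one measurableSet_ball]
  refine mul_le_mul_right (lintegral_mono fun u => ?_) _
  by_cases hu : e + L u ∈ S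
  · suffices huB : u ∈ Metric.ball (0 : E) 2 by
      rw [indicator_of_mem hu, indicator_of_mem huB, Pi.one_apply, Pi.one_apply]
    obtain ⟨h1, h2⟩ := hu
    have h3 : (inner ℂ e (e + L u) : ℂ) = 1 + (2 * t : ℝ) * inner ℂ e u := by
      rw [inner_add_right, inner_anisoScaling he hb, inner_self_eq_norm_sq_to_K, he]
      simp
    have h4 : e + L u - (inner ℂ e (e + L u) : ℂ) • e =
        ((2 * √t : ℝ) : ℂ) • (u - (inner ℂ e u : ℂ) • e) := by
      rw [h3, hL, anisoScaling_apply e hb]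
      push_cast
      module
    rw [h4, norm_smul, mul_pow, Complex.norm_real, Real.norm_of_nonneg (by positivity), mul_pow,
      Real.sq_sqrt ht.le] at h2
    rw [h3, sub_add_cancel_left, norm_neg, norm_mul, Complex.norm_real,
      Real.norm_of_nonneg (by positivity)] at h1
    have h5 : ‖inner ℂ e u‖ < 1 := by
      by_contra! h
      nlinarith
    have h6 : ‖u - (inner ℂ e u : ℂ) • e‖ ^ 2 ≤ 1 := by
      by_contra! h
      nlinarith
    have h7 := norm_sq_eq_add he u
    rw [mem_ball_zero_iff]
    nlinarith [norm_nonneg u, norm_nonneg (inner ℂ e u : ℂ)]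
  · rw [indicator_of_notMem hu]
    exact zero_le

/-- Integral of the weight along a real line in the direction `e`. -/
lemma lintegral_line_le {α : ℝ} (hα : -1 < α) {e : E} (he : ‖e‖ = 1) {t : ℝ} (ht : 0 < t)
    (ht2 : t ≤ 1 / 2) (z : E) :
    ∫⁻ s in Ioo 0 t, (Metric.ball (0 : E) 1 ∩ {z | ‖1 - inner ℂ e z‖ < t}).indicator
      (fun z => ENNReal.ofReal ((1 - ‖z‖ ^ 2) ^ α)) (z + (s : ℂ) • e) ≤
      ENNReal.ofReal ((2 ^ |α| + 1 / (α + 1)) * t ^ (α + 1)) := by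
  set S := Metric.ball (0 : E) 1 ∩ {z | ‖1 - inner ℂ e z‖ < t} with hS
  have hα1 : 0 < α + 1 := by linarith
  -- For `α ≥ 0` the weight is at most `(2t)^α` on `S`. For `α < 0` it blows up at the sphere and
  -- the integration along the line is essential. The constant is the sum of those from the two
  -- cases.
  rcases le_or_gt 0 α with h0 | h0
  · have hle : ∀ w, S.indicator (fun z => ENNReal.ofReal ((1 - ‖z‖ ^ 2) ^ α)) w ≤
        ENNReal.ofReal ((2 * t) ^ α) := by
      intro w
      by_cases hw : w ∈ S
      swap
      · rw [indicator_of_notMem hw]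
        exact zero_le
      rw [indicator_of_mem hw]
      have hw1 : ‖w‖ < 1 := mem_ball_zero_iff.1 hw.1
      have hw2 : ‖1 - inner ℂ e w‖ < t := hw.2
      have h2 := norm_sub_norm_le (1 : ℂ) (inner ℂ e w)
      have h3 := norm_inner_le_norm (𝕜 := ℂ) e w
      rw [he, one_mul] at h3
      rw [norm_one] at h2
      apply ENNReal.ofReal_le_ofReal
      exact Real.rpow_le_rpow (one_sub_norm_sq_pos hw1).le (by nlinarith [norm_nonneg w]) h0
    refine (lintegral_mono fun s => hle _).trans ?_
    rw [setLIntegral_const, Real.volume_Ioo, sub_zero, ← ENNReal.ofReal_mul (by positivity)]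
    apply ENNReal.ofReal_le_ofReal
    rw [Real.mul_rpow (by norm_num) ht.le, mul_assoc, ← Real.rpow_add_one ht.ne',
      abs_of_nonneg h0]
    gcongr
    linarith [show 0 < 1 / (α + 1) by positivity]
  -- On the part of the line inside `S`, `Re⟨e, z + s e⟩ > 1 - t ≥ 1/2`, so `‖z + s e‖²` grows at
  -- rate at least one there. Hence `1 - ‖z + s e‖²` dominates the distance from `s` to the last
  -- parameter `σ` in `S`.
  set A := {s : ℝ | s ∈ Ioo 0 t ∧ z + (s : ℂ) • e ∈ S} with hA
  have hAb : BddAbove A := ⟨t, fun s hs => hs.1.2.le⟩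
  set σ := sSup A with hσ
  have hkey : ∀ s ∈ A, ∀ s' ∈ A, s < s' → s' - s ≤ 1 - ‖z + (s : ℂ) • e‖ ^ 2 := by
    intro s hs s' hs' hss
    have hw1 : ‖z + (s' : ℂ) • e‖ < 1 := mem_ball_zero_iff.1 hs'.2.1
    have hre : ∀ q ∈ A, 1 / 2 ≤ (inner ℂ e z : ℂ).re + q := by
      intro q hq
      have h1 : ‖1 - inner ℂ e (z + (q : ℂ) • e)‖ < t := hq.2.2
      rw [inner_add_right, inner_smul_right, inner_self_eq_norm_sq_to_K, he] at h1
      have h2 := Complex.re_le_norm (1 - ((inner ℂ e z : ℂ) + q * ((1 : ℝ) : ℂ) ^ 2))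
      have h3 : (1 - ((inner ℂ e z : ℂ) + q * ((1 : ℝ) : ℂ) ^ 2)).re =
        1 - (inner ℂ e z : ℂ).re - q := by simp; ring
      rw [h3] at h2
      have h4 := h2.trans_lt h1
      linarith
    have hsq : ∀ q : ℝ, ‖z + (q : ℂ) • e‖ ^ 2 =
        ‖z‖ ^ 2 + 2 * q * (inner ℂ e z : ℂ).re + q ^ 2 := by
      intro q
      rw [norm_add_sq (𝕜 := ℂ), inner_smul_right, norm_smul, he, mul_one, Complex.norm_real,
        Real.norm_eq_abs, sq_abs]
      have h := inner_re_symm (𝕜 := ℂ) z e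
      simp only [RCLike.re_eq_complex_re] at h
      simp [h]
      ring
    have hw2 := hsq s'
    rw [hsq s]
    nlinarith [norm_nonneg (z + (s' : ℂ) • e), hre s hs, hre s' hs']
  -- For negative `α` this domination gives weight at most `(σ - s)^α`, integrable since `α > -1`.
  -- The point `s = σ` must be left out, as the right side vanishes there, but it is a null set.
  have hpt : ∀ s ∈ Ioo 0 t, s ≠ σ →
      S.indicator (fun z => ENNReal.ofReal ((1 - ‖z‖ ^ 2) ^ α)) (z + (s : ℂ) • e) ≤
      (Ioc 0 t).indicator (fun x => ENNReal.ofReal (x ^ α)) (σ - s) := by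
    intro s hs hne
    by_cases hsA : z + (s : ℂ) • e ∈ S
    · have hs1 : s ∈ A := ⟨hs, hsA⟩
      have hlt : s < σ := lt_of_le_of_ne (le_csSup hAb hs1) hne
      have hσt : σ ≤ t := csSup_le ⟨s, hs1⟩ fun q hq => hq.1.2.le
      have hle : σ ≤ s + (1 - ‖z + (s : ℂ) • e‖ ^ 2) := by
        refine csSup_le ⟨s, hs1⟩ fun q hq => ?_
        rcases le_or_gt q s with h | h
        · have := one_sub_norm_sq_pos (mem_ball_zero_iff.1 hsA.1)
          linarith
        · linarith [hkey s hs1 q hq h]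
      rw [indicator_of_mem hsA, indicator_of_mem (by constructor <;> linarith [hs.1])]
      apply ENNReal.ofReal_le_ofReal
      exact Real.rpow_le_rpow_of_nonpos (by linarith) (by linarith) h0.le
    · rw [indicator_of_notMem hsA]
      exact zero_le
  calc _ ≤ ∫⁻ s in Ioo 0 t, (Ioc 0 t).indicator (fun x => ENNReal.ofReal (x ^ α)) (σ - s) := by
        refine lintegral_mono_ae ?_
        rw [ae_restrict_iff' measurableSet_Ioo]
        have : ∀ᵐ s : ℝ, s ≠ σ := by simp [ae_iff]
        filter_upwards [this] with s hs hs' using hpt s hs' hs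
    _ ≤ ∫⁻ s, (Ioc 0 t).indicator (fun x => ENNReal.ofReal (x ^ α)) (σ - s) :=
        setLIntegral_le_lintegral _ _
    _ = ENNReal.ofReal (t ^ (α + 1) / (α + 1)) := by
        rw [lintegral_sub_left_eq_self, lintegral_indicator measurableSet_Ioc,
          lintegral_Ioc_rpow hα ht]
    _ ≤ _ := by
        apply ENNReal.ofReal_le_ofReal
        rw [add_mul, div_eq_inv_mul, one_div]
        have : 0 ≤ (2 : ℝ) ^ |α| * t ^ (α + 1) := by positivity
        linarith

/-- By translation invariance, `t ∫ f` is the integral over `z` of the line integrals of `f` along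
`z + s e`, `0 < s < t`. Each is at most a constant times `t^(α+1)` and vanishes off a region `R` of
volume of order at most `t^(N+1)`; division by `t` leaves `t^(N+1+α)`. -/
lemma exists_lintegral_nonisotropic_le {α : ℝ} (hα : -1 < α) :
    ∃ C : ℝ≥0∞, C ≠ ∞ ∧ ∀ e : E, ‖e‖ = 1 → ∀ t : ℝ, 0 < t → t ≤ 1 / 2 →
      ∫⁻ z, (Metric.ball (0 : E) 1 ∩ {z | ‖1 - inner ℂ e z‖ < t}).indicator
        (fun z => ENNReal.ofReal ((1 - ‖z‖ ^ 2) ^ α)) z ≤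
          C * ENNReal.ofReal (t ^ ((N : ℝ) + 1 + α)) := by
  refine ⟨ENNReal.ofReal (2 ^ |α| + 1 / (α + 1)) *
    (ENNReal.ofReal (4 ^ N) * volume (Metric.ball (0 : E) 2)), ?_, ?_⟩
  · exact ENNReal.mul_ne_top ENNReal.ofReal_ne_top (ENNReal.mul_ne_top ENNReal.ofReal_ne_top
      measure_ball_lt_top.ne)
  intro e he t ht ht2
  have hα1 : 0 < α + 1 := by linarith
  have hCα : 0 ≤ 2 ^ |α| + 1 / (α + 1) := by positivity
  set S := Metric.ball (0 : E) 1 ∩ {z | ‖1 - inner ℂ e z‖ < t} with hS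
  have hSm : MeasurableSet S :=
    measurableSet_ball.inter (isOpen_lt (by fun_prop) continuous_const).measurableSet
  set f : E → ℝ≥0∞ := S.indicator fun z => ENNReal.ofReal ((1 - ‖z‖ ^ 2) ^ α) with hf
  have hfm : Measurable f := Measurable.indicator (by fun_prop) hSm
  set R := {z : E | ‖1 - inner ℂ e z‖ < 2 * t ∧ ‖z - (inner ℂ e z : ℂ) • e‖ ^ 2 ≤ 2 * t} with hR
  have hRm : MeasurableSet R := measurableSet_nonisotropic e _ _
  have hmem : ∀ z : E, ∀ s ∈ Ioo 0 t, z + (s : ℂ) • e ∈ S → z ∈ R := by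
    intro z s hs hz
    have h1 : ‖1 - inner ℂ e (z + (s : ℂ) • e)‖ < t := hz.2
    have h2 := norm_sub_inner_smul_sq_le he (mem_ball_zero_iff.1 hz.1) (by linarith) h1
    have h3 : (inner ℂ e (z + (s : ℂ) • e) : ℂ) = inner ℂ e z + s := by
      rw [inner_add_right, inner_smul_right, inner_self_eq_norm_sq_to_K, he]; simp
    rw [h3] at h1 h2
    refine ⟨?_, ?_⟩
    · have : (1 : ℂ) - inner ℂ e z = (1 - (inner ℂ e z + s)) + s := by ring
      rw [this]
      refine (norm_add_le _ _).trans_lt ?_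
      rw [Complex.norm_real, Real.norm_of_nonneg hs.1.le]
      linarith [hs.2]
    · rwa [add_smul, add_sub_add_right_eq_sub] at h2
  have hline : ∀ z : E, ∫⁻ s in Ioo 0 t, f (z + (s : ℂ) • e) ≤
      R.indicator (fun _ => ENNReal.ofReal ((2 ^ |α| + 1 / (α + 1)) * t ^ (α + 1))) z := by
    intro z
    by_cases hz : z ∈ R
    · rw [indicator_of_mem hz]
      exact lintegral_line_le hα he ht ht2 z
    · rw [indicator_of_notMem hz, nonpos_iff_eq_zero]
      refine (setLIntegral_congr_fun measurableSet_Ioo fun s hs => ?_).trans lintegral_zero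
      exact indicator_of_notMem (fun h => hz (hmem z s hs h)) _
  have hmain : ENNReal.ofReal t * ∫⁻ z, f z ≤ ENNReal.ofReal t *
      (ENNReal.ofReal (2 ^ |α| + 1 / (α + 1)) *
    (ENNReal.ofReal (4 ^ N) * volume (Metric.ball (0 : E) 2)) *
      ENNReal.ofReal (t ^ ((N : ℝ) + 1 + α))) := by
    calc ENNReal.ofReal t * ∫⁻ z, f z = ∫⁻ s in Ioo 0 t, ∫⁻ z, f (z + (s : ℂ) • e) := by
          simp_rw [lintegral_add_right_eq_self f]
          rw [setLIntegral_const, Real.volume_Ioo, sub_zero, mul_comm]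
      _ = ∫⁻ z, ∫⁻ s in Ioo 0 t, f (z + (s : ℂ) • e) := by
          refine lintegral_lintegral_swap (Measurable.aemeasurable ?_)
          exact hfm.comp (by fun_prop)
      _ ≤ ∫⁻ z, R.indicator
          (fun _ => ENNReal.ofReal ((2 ^ |α| + 1 / (α + 1)) * t ^ (α + 1))) z :=
          lintegral_mono hline
      _ = ENNReal.ofReal ((2 ^ |α| + 1 / (α + 1)) * t ^ (α + 1)) * volume R := by
          rw [lintegral_indicator hRm, setLIntegral_const]
      _ ≤ ENNReal.ofReal ((2 ^ |α| + 1 / (α + 1)) * t ^ (α + 1)) *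
          (ENNReal.ofReal (4 ^ N * t ^ (N + 1)) * volume (Metric.ball (0 : E) 2)) :=
          mul_le_mul_right (volume_nonisotropic_le he ht) _
      _ = _ := by
          rw [ENNReal.ofReal_mul hCα, ENNReal.ofReal_mul (by positivity)]
          have : t * t ^ ((N : ℝ) + 1 + α) = t ^ (α + 1) * t ^ (N + 1) := by
            rw [← Real.rpow_one_add' ht.le (by have : (0:ℝ) ≤ N := N.cast_nonneg; linarith),
              ← Real.rpow_natCast, ← Real.rpow_add ht]
            push_cast
            ring_nf
          have h2 : ENNReal.ofReal t * ENNReal.ofReal (t ^ ((N : ℝ) + 1 + α)) =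
              ENNReal.ofReal (t ^ (α + 1)) * ENNReal.ofReal (t ^ (N + 1)) := by
            rw [← ENNReal.ofReal_mul ht.le, this, ENNReal.ofReal_mul (by positivity)]
          calc _ = ENNReal.ofReal (2 ^ |α| + 1 / (α + 1)) * (ENNReal.ofReal (4 ^ N) *
                volume (Metric.ball (0 : E) 2)) * (ENNReal.ofReal (t ^ (α + 1)) *
                ENNReal.ofReal (t ^ (N + 1))) := by ring
            _ = _ := by rw [← h2]; ring
  exact (ENNReal.mul_le_mul_iff_right (ENNReal.ofReal_pos.2 ht).ne' ENNReal.ofReal_ne_top).1 hmain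

/-- The `v_α`-measure of a non-isotropic neighbourhood of a boundary point. -/
lemma exists_bergmanMeasure_nonisotropic_le (hN : 1 ≤ N) {α : ℝ} (hα : -1 < α) :
    ∃ C : ℝ≥0∞, C ≠ ∞ ∧ ∀ e : E, ‖e‖ = 1 → ∀ t : ℝ, 0 < t →
      bergmanMeasure N α {z | ‖1 - inner ℂ e (z : E)‖ < t} ≤
        C * ENNReal.ofReal (t ^ ((N : ℝ) + 1 + α)) := by
  obtain ⟨C, hC, h⟩ := exists_lintegral_nonisotropic_le (N := N) hα
  have hfin := isFiniteMeasure_bergmanMeasure hN hα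
  have hp : 0 < (N : ℝ) + 1 + α := by have : (0:ℝ) ≤ N := N.cast_nonneg; linarith
  refine ⟨bergmanFactor N α * C +
    bergmanMeasure N α univ * ENNReal.ofReal (2 ^ ((N : ℝ) + 1 + α)), ?_, ?_⟩
  · exact ENNReal.add_ne_top.2 ⟨ENNReal.mul_ne_top (bergmanFactor_ne_top α) hC,
      ENNReal.mul_ne_top (measure_ne_top _ _) ENNReal.ofReal_ne_top⟩
  intro e he t ht
  rw [add_mul]
  rcases le_or_gt t (1 / 2) with ht2 | ht2
  · refine le_trans ?_ le_self_add
    have hSm : MeasurableSet {z : E | ‖1 - inner ℂ e z‖ < t} :=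
      (isOpen_lt (by fun_prop) continuous_const).measurableSet
    have h1 := lintegral_bergmanMeasure hα ({z : E | ‖1 - inner ℂ e z‖ < t}.indicator 1)
    have h2 : ∫⁻ z : UnitBall N, ({z : E | ‖1 - inner ℂ e z‖ < t}.indicator 1) (z : E)
        ∂(bergmanMeasure N α) = bergmanMeasure N α {z | ‖1 - inner ℂ e (z : E)‖ < t} :=
      lintegral_indicator_one (measurable_subtype_coe hSm)
    rw [← h2, h1, mul_assoc]
    refine mul_le_mul_right (le_trans (le_of_eq ?_) (h e he t ht ht2)) _
    rw [← lintegral_indicator measurableSet_ball]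
    refine lintegral_congr fun z => ?_
    by_cases hz1 : z ∈ Metric.ball (0 : E) 1 <;> by_cases hz2 : ‖1 - inner ℂ e z‖ < t <;>
      simp [indicator, hz2]
  -- For `t > 1/2` the total mass suffices, since `(2t)^p ≥ 1`.
  · refine le_trans ?_ le_add_self
    rw [mul_assoc, ← ENNReal.ofReal_mul (by positivity), ← Real.mul_rpow (by norm_num) ht.le]
    refine (measure_mono (subset_univ _)).trans (le_mul_of_one_le_right zero_le ?_)
    rw [← ENNReal.ofReal_one]
    exact ENNReal.ofReal_le_ofReal (Real.one_le_rpow (by linarith) hp.le)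

end NonisotropicVolume

/-! ### From Carleson windows to integral embeddings -/

section CarlesonEmbedding

variable {N : ℕ}

local notation "E" => EuclideanSpace ℂ (Fin N)

lemma isOpen_isNear : IsOpen {q : UnitBall N × UnitBall N | IsNear (q.1 : E) (q.2 : E)} := by
  have h1 : IsOpen {q : UnitBall N × UnitBall N |
      ‖1 - inner ℂ (q.1 : E) (q.2 : E)‖ < 3 * (1 - ‖(q.1 : E)‖)} :=
    isOpen_lt (by fun_prop) (by fun_prop)
  have h2 : IsOpen {q : UnitBall N × UnitBall N |
      1 - ‖(q.1 : E)‖ < 5 * (1 - ‖(q.2 : E)‖ ^ 2)} :=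
    isOpen_lt (by fun_prop) (by fun_prop)
  exact h1.inter h2

lemma exponent_pos (N : ℕ) {α : ℝ} (hα : -1 < α) : 0 < (N : ℝ) + 1 + α := by
  have : (0 : ℝ) ≤ N := N.cast_nonneg
  linarith

lemma continuous_domRestrict_ball {F : E → ℂ} (hF : DifferentiableOn ℂ F (Metric.ball 0 1)) :
    Continuous fun z : UnitBall N => F z :=
  hF.continuousOn.domRestrict

/-- Integrate the local mean value inequality against `μ` and apply Tonelli. For fixed `w`, the
factor `(1-‖z‖)^(-p)` is at most `(6/(1-‖w‖²))^p` near `w`, and this cancels against the assumed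
mass. The linear dependence on `κ` is what makes the embedding constant small for a vanishing
measure restricted to a neighbourhood of the sphere. -/
lemma exists_lintegral_le_of_measure_isNear_le (hN : 1 ≤ N) {α : ℝ} (hα : -1 < α) :
    ∃ C : ℝ≥0∞, C ≠ ∞ ∧ ∀ (μ : Measure (UnitBall N)) [IsFiniteMeasure μ] (κ : ℝ≥0∞),
      (∀ w : UnitBall N, μ {z | IsNear (z : E) w} ≤
        κ * ENNReal.ofReal ((1 - ‖(w : E)‖ ^ 2) ^ ((N : ℝ) + 1 + α))) →
      ∀ (ψ : OrliczFunction) (F : E → ℂ), DifferentiableOn ℂ F (Metric.ball 0 1) →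
      ∀ c : ℝ, 0 < c → ∫⁻ z : UnitBall N, ENNReal.ofReal (ψ (‖F z‖ / c)) ∂μ ≤
        C * κ * ∫⁻ z : UnitBall N, ENNReal.ofReal (ψ (‖F z‖ / c)) ∂(bergmanMeasure N α) := by
  obtain ⟨C, hC, hmv⟩ := exists_map_norm_le_lintegral_isNear hN hα
  have hfin := isFiniteMeasure_bergmanMeasure hN hα
  set p := (N : ℝ) + 1 + α with hp
  have hp0 : 0 < p := exponent_pos N hα
  refine ⟨C * ENNReal.ofReal (6 ^ p), ENNReal.mul_ne_top hC ENNReal.ofReal_ne_top, ?_⟩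
  intro μ _ κ hκ ψ F hF c hc
  set u : E → ℝ≥0∞ := fun w => ENNReal.ofReal (ψ (‖F w‖ / c)) with hu
  have hFc := continuous_domRestrict_ball hF
  have hpt : ∀ z : UnitBall N, u z ≤ C * ∫⁻ w : UnitBall N,
      {q : UnitBall N × UnitBall N | IsNear (q.1 : E) q.2}.indicator
        (fun q => ENNReal.ofReal ((1 - ‖(q.1 : E)‖) ^ (-p)) * u q.2) (z, w)
        ∂(bergmanMeasure N α) := by
    -- The factor `(1-‖z‖)^(-p)` is put inside the integral so that the integrand becomes a function
    -- of the pair `(z, w)`, ready for Tonelli.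
    intro z
    have hz : 0 < 1 - ‖(z : E)‖ := by linarith [z.norm_lt_one]
    have h := hmv ψ F hF c hc z
    have h2 : ∀ w : UnitBall N, {q : UnitBall N × UnitBall N | IsNear (q.1 : E) q.2}.indicator
        (fun q => ENNReal.ofReal ((1 - ‖(q.1 : E)‖) ^ (-p)) * u q.2) (z, w) =
        ENNReal.ofReal ((1 - ‖(z : E)‖) ^ (-p)) *
          {w : E | IsNear (z : E) w}.indicator u w := by
      intro w
      by_cases hw : IsNear (z : E) w <;> simp [indicator, hw]
    simp_rw [h2]
    rw [lintegral_const_mul' _ _ ENNReal.ofReal_ne_top, mul_left_comm]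
    refine le_trans (le_of_eq ?_) (mul_le_mul_right h _)
    rw [← mul_assoc, ← ENNReal.ofReal_mul (by positivity), ← Real.rpow_add hz, neg_add_cancel,
      Real.rpow_zero, ENNReal.ofReal_one, one_mul]
  have hmeas : AEMeasurable (fun q : UnitBall N × UnitBall N =>
      {q : UnitBall N × UnitBall N | IsNear (q.1 : E) q.2}.indicator
        (fun q => ENNReal.ofReal ((1 - ‖(q.1 : E)‖) ^ (-p)) * u q.2) q)
      (μ.prod (bergmanMeasure N α)) := by
    have h1 : AEMeasurable (fun q : UnitBall N × UnitBall N =>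
        ENNReal.ofReal ((1 - ‖(q.1 : E)‖) ^ (-p))) (μ.prod (bergmanMeasure N α)) :=
      Measurable.aemeasurable (by fun_prop)
    have h2 : AEMeasurable (fun q : UnitBall N × UnitBall N => u q.2)
        (μ.prod (bergmanMeasure N α)) :=
      ψ.measurable_comp_norm (hFc.comp continuous_snd).measurable.aemeasurable c hc
    exact (h1.mul h2).indicator isOpen_isNear.measurableSet
  calc ∫⁻ z : UnitBall N, u z ∂μ
      ≤ ∫⁻ z : UnitBall N, C * ∫⁻ w : UnitBall N,
        {q : UnitBall N × UnitBall N | IsNear (q.1 : E) q.2}.indicator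
        (fun q => ENNReal.ofReal ((1 - ‖(q.1 : E)‖) ^ (-p)) * u q.2) (z, w)
        ∂(bergmanMeasure N α) ∂μ := lintegral_mono hpt
    _ = C * ∫⁻ w : UnitBall N, ∫⁻ z : UnitBall N,
        {q : UnitBall N × UnitBall N | IsNear (q.1 : E) q.2}.indicator
        (fun q => ENNReal.ofReal ((1 - ‖(q.1 : E)‖) ^ (-p)) * u q.2) (z, w)
        ∂μ ∂(bergmanMeasure N α) := by
        rw [lintegral_const_mul' _ _ hC, lintegral_lintegral_swap hmeas]
    _ ≤ C * ∫⁻ w : UnitBall N, ENNReal.ofReal (6 ^ p) * κ * u w ∂(bergmanMeasure N α) := by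
        refine mul_le_mul_right (lintegral_mono fun w => ?_) _
        have hs : 0 < 1 - ‖(w : E)‖ ^ 2 := one_sub_norm_sq_pos w.norm_lt_one
        have hset : MeasurableSet {z : UnitBall N | IsNear (z : E) w} :=
          (isOpen_isNear.preimage (by fun_prop : Continuous fun z : UnitBall N => (z, w))
            ).measurableSet
        have h1 : ∀ z : UnitBall N, {q : UnitBall N × UnitBall N | IsNear (q.1 : E) q.2}.indicator
            (fun q => ENNReal.ofReal ((1 - ‖(q.1 : E)‖) ^ (-p)) * u q.2) (z, w) ≤
            {z : UnitBall N | IsNear (z : E) w}.indicator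
              (fun _ => ENNReal.ofReal ((6 / (1 - ‖(w : E)‖ ^ 2)) ^ p) * u w) z := by
          intro z
          by_cases hz : IsNear (z : E) w
          · have hr : 0 < 1 - ‖(z : E)‖ := by linarith [z.norm_lt_one]
            rw [indicator_of_mem (by exact hz), indicator_of_mem (by exact hz)]
            refine mul_le_mul_left (ENNReal.ofReal_le_ofReal ?_) _
            rw [Real.rpow_neg hr.le, ← Real.inv_rpow hr.le]
            refine Real.rpow_le_rpow (by positivity) ?_ hp0.le
            rw [inv_eq_one_div, div_le_div_iff₀ hr hs]
            linarith [hz.one_sub_norm_sq_lt z.norm_lt_one w.norm_lt_one]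
          · rw [indicator_of_notMem (by exact hz)]
            exact zero_le
        refine (lintegral_mono h1).trans ?_
        rw [lintegral_indicator_const hset]
        refine (mul_le_mul_right (hκ w) _).trans (le_of_eq ?_)
        have h2 : (6 / (1 - ‖(w : E)‖ ^ 2)) ^ p * (1 - ‖(w : E)‖ ^ 2) ^ p = 6 ^ p := by
          rw [← Real.mul_rpow (by positivity) hs.le, div_mul_cancel₀ _ hs.ne']
        rw [← h2, ENNReal.ofReal_mul (by positivity)]
        ring
    _ = _ := by
        rw [lintegral_const_mul'' _ (ψ.measurable_comp_norm hFc.measurable.aemeasurable c hc)]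
        ring

lemma mem_unitSphere_iff {e : E} : e ∈ unitSphere N ↔ ‖e‖ = 1 := mem_sphere_zero_iff_norm

/-- The origin is excluded automatically: `0⁻¹ • 0 = 0` is not on the sphere. The order of the
arguments of the inner product is immaterial because conjugation preserves the modulus. -/
lemma mem_carlesonWindow_iff {e : E} {h : ℝ} {z : UnitBall N} : z ∈ carlesonWindow e h ↔
    (z : E) ≠ 0 ∧ 1 - ‖(z : E)‖ < h ∧ ‖1 - inner ℂ e ((‖(z : E)‖⁻¹ : ℂ) • (z : E))‖ < h := by
  have h1 : ∀ x y : E, ‖(1 : ℂ) - inner ℂ x y‖ = ‖(1 : ℂ) - inner ℂ y x‖ := by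
    intro x y
    rw [← inner_conj_symm, ← RCLike.norm_conj]
    simp
  simp only [carlesonWindow, sphereBall, mem_ofPred_eq, mem_unitSphere_iff, nonisotropicDist,
    Real.sq_sqrt (norm_nonneg _), h1 e]
  have h2 : ‖(‖(z : E)‖⁻¹ : ℂ) • (z : E)‖ = 1 ↔ (z : E) ≠ 0 := by
    rw [norm_smul, norm_inv, Complex.norm_real, norm_norm]
    refine ⟨fun h h0 => ?_, fun h => inv_mul_cancel₀ (norm_ne_zero_iff.2 h)⟩
    rw [h0] at h
    simp at h
  rw [h2]
  tauto

lemma isOpen_carlesonWindow (e : E) (h : ℝ) : IsOpen (carlesonWindow e h) := by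
  have hopen : IsOpen {z : UnitBall N | (z : E) ≠ 0} :=
    isOpen_ne.preimage continuous_subtype_val
  have hcont : ContinuousOn (fun z : UnitBall N =>
      ‖1 - inner ℂ e ((‖(z : E)‖⁻¹ : ℂ) • (z : E))‖) {z | (z : E) ≠ 0} := by
    have h0 : ContinuousOn (fun z : UnitBall N => (‖(z : E)‖⁻¹ : ℂ)) {z | (z : E) ≠ 0} := by
      refine ContinuousOn.inv₀ (by fun_prop) fun z hz => ?_
      exact_mod_cast norm_ne_zero_iff.2 hz
    fun_prop
  have h1 := hcont.isOpen_inter_preimage hopen (isOpen_Iio (a := h))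
  have h2 : IsOpen {z : UnitBall N | 1 - ‖(z : E)‖ < h} :=
    isOpen_lt (by fun_prop) continuous_const
  convert h2.inter h1 using 1
  ext z
  rw [mem_carlesonWindow_iff]
  simp only [mem_inter_iff, mem_ofPred_eq, mem_preimage, mem_Iio]
  tauto

lemma measure_carlesonWindow_le (μ : Measure (UnitBall N)) {e : E} (he : ‖e‖ = 1) (h : ℝ) :
    μ (carlesonWindow e h) ≤ carlesonRho μ h :=
  le_iSup₂ (f := fun ξ (_ : ξ ∈ unitSphere N) => μ (carlesonWindow ξ h)) e
    (mem_unitSphere_iff.2 he)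

/-- With `s = 1-‖w‖²` and `r = 1-‖z‖ < 5s`, one has `|1-⟨z,w⟩| < 3r < 15s`, while normalizing both
vectors moves the inner product by at most `r + s < 6s`; whence `15 + 6 = 21`. The bound `21 s ≤ 1`
keeps `z` and `w` away from the origin, where they could not be normalized. -/
lemma IsNear.mem_carlesonWindow {z w : UnitBall N} (h : IsNear (z : E) w)
    (hw : 21 * (1 - ‖(w : E)‖ ^ 2) ≤ 1) :
    z ∈ carlesonWindow ((‖(w : E)‖⁻¹ : ℂ) • (w : E)) (21 * (1 - ‖(w : E)‖ ^ 2)) := by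
  set s := 1 - ‖(w : E)‖ ^ 2 with hs
  have hs0 : 0 < s := one_sub_norm_sq_pos w.norm_lt_one
  have hz1 := z.norm_lt_one
  have hw1 := w.norm_lt_one
  set r := 1 - ‖(z : E)‖ with hr
  have hr0 : 0 < r := by linarith
  obtain ⟨h1, h2⟩ := h
  have hz0 : 0 < ‖(z : E)‖ := by linarith
  have hw0 : 0 < ‖(w : E)‖ := by
    rcases eq_or_lt_of_le (norm_nonneg (w : E)) with h | h
    · rw [← h] at hs; linarith
    · exact h
  have hz0' : (‖(z : E)‖ : ℂ) ≠ 0 := by exact_mod_cast hz0.ne'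
  have hw0' : (‖(w : E)‖ : ℂ) ≠ 0 := by exact_mod_cast hw0.ne'
  rw [mem_carlesonWindow_iff]
  refine ⟨norm_pos_iff.1 hz0, by linarith, ?_⟩
  set a : ℂ := inner ℂ (z : E) w with ha
  have hna : ‖a‖ ≤ ‖(z : E)‖ * ‖(w : E)‖ := norm_inner_le_norm _ _
  set b : ℂ := (‖(z : E)‖ : ℂ)⁻¹ * ((‖(w : E)‖ : ℂ)⁻¹ * a) with hb
  have hab : a = ‖(z : E)‖ * ‖(w : E)‖ * b := by rw [hb]; field_simp
  have hnb : ‖b‖ ≤ 1 := by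
    rw [hb, norm_mul, norm_mul, norm_inv, norm_inv, Complex.norm_real, Complex.norm_real,
      norm_norm, norm_norm, ← mul_assoc, ← mul_inv, inv_mul_le_iff₀ (by positivity), mul_one]
    exact hna
  have hnorm : ‖(1 : ℂ) - inner ℂ ((‖(w : E)‖⁻¹ : ℂ) • (w : E)) ((‖(z : E)‖⁻¹ : ℂ) • (z : E))‖ =
      ‖1 - b‖ := by
    rw [← RCLike.norm_conj, map_sub, map_one, inner_conj_symm, inner_smul_left, inner_smul_right,
      hb, ha]
    simp
  rw [hnorm]
  have : 1 - b = (1 - a) + ((‖(z : E)‖ * ‖(w : E)‖ - 1 : ℝ) : ℂ) * b := by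
    rw [hab]; push_cast; ring
  rw [this]
  refine (norm_add_le _ _).trans_lt ?_
  rw [norm_mul, Complex.norm_real]
  have h3 : ‖(‖(z : E)‖ * ‖(w : E)‖ - 1 : ℝ)‖ ≤ r + s := by
    rw [Real.norm_eq_abs, abs_le]
    constructor <;> nlinarith
  nlinarith [norm_nonneg b, norm_nonneg (‖(z : E)‖ * ‖(w : E)‖ - 1 : ℝ)]

lemma measure_isNear_le_of_carlesonRho_le {μ : Measure (UnitBall N)} {α δ : ℝ} (hδ : δ ≤ 1)
    {κ : ℝ≥0∞} (hκ : ∀ t ∈ Ioc 0 δ, carlesonRho μ t ≤ κ * ENNReal.ofReal (t ^ ((N : ℝ) + 1 + α)))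
    (w : UnitBall N) (hw : 21 * (1 - ‖(w : E)‖ ^ 2) ≤ δ) :
    μ {z | IsNear (z : E) w} ≤ κ * ENNReal.ofReal (21 ^ ((N : ℝ) + 1 + α)) *
      ENNReal.ofReal ((1 - ‖(w : E)‖ ^ 2) ^ ((N : ℝ) + 1 + α)) := by
  have hs0 : 0 < 1 - ‖(w : E)‖ ^ 2 := one_sub_norm_sq_pos w.norm_lt_one
  have hw0 : ‖(w : E)‖ ≠ 0 := by
    intro h
    rw [h] at hw
    norm_num at hw
    linarith
  refine (measure_mono fun z hz => IsNear.mem_carlesonWindow hz (hw.trans hδ)).trans ?_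
  refine (measure_carlesonWindow_le μ ?_ _).trans ((hκ _ ⟨by positivity, hw⟩).trans ?_)
  · rw [norm_smul, norm_inv, Complex.norm_real, norm_norm, inv_mul_cancel₀ hw0]
  · rw [Real.mul_rpow (by norm_num) hs0.le, ENNReal.ofReal_mul (by positivity), mul_assoc]

end CarlesonEmbedding

/-! ### Test functions peaking at a boundary point -/

section TestFunctions

variable {N : ℕ}

local notation "E" => EuclideanSpace ℂ (Fin N)

/-- The function `z ↦ (h / (1 - (1 - h) ⟨z, e⟩))^k`. -/
def kernelPow (e : E) (h : ℝ) (k : ℕ) (z : E) : ℂ :=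
  ((h : ℂ) / (1 - ((1 - h : ℝ) : ℂ) * inner ℂ e z)) ^ k

lemma le_norm_one_sub_mul_inner {e : E} (he : ‖e‖ = 1) {h : ℝ} (h1 : h ≤ 1) {z : E}
    (hz : ‖z‖ < 1) : h ≤ ‖1 - ((1 - h : ℝ) : ℂ) * inner ℂ e z‖ := by
  have h2 := norm_sub_norm_le (1 : ℂ) (((1 - h : ℝ) : ℂ) * inner ℂ e z)
  have h3 := norm_inner_le_norm (𝕜 := ℂ) e z
  rw [he, one_mul] at h3
  rw [norm_one, norm_mul, Complex.norm_real, Real.norm_of_nonneg (by linarith)] at h2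
  nlinarith

lemma differentiableOn_kernelPow {e : E} (he : ‖e‖ = 1) {h : ℝ} (h0 : 0 < h) (h1 : h ≤ 1) (k : ℕ) :
    DifferentiableOn ℂ (kernelPow e h k) (Metric.ball 0 1) := by
  intro z hz
  have hne : 1 - ((1 - h : ℝ) : ℂ) * inner ℂ e z ≠ 0 := by
    rw [← norm_pos_iff]
    exact h0.trans_le (le_norm_one_sub_mul_inner he h1 (mem_ball_zero_iff.1 hz))
  have hd : DifferentiableAt ℂ (fun z : E => (inner ℂ e z : ℂ)) z :=
    (innerSL ℂ e).differentiableAt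
  have hden : DifferentiableAt ℂ (fun z : E => 1 - ((1 - h : ℝ) : ℂ) * inner ℂ e z) z :=
    (hd.const_mul _).const_sub _
  have hdiv : DifferentiableAt ℂ
      (fun z : E => (h : ℂ) / (1 - ((1 - h : ℝ) : ℂ) * inner ℂ e z)) z := by
    simp only [div_eq_mul_inv]
    exact (hden.fun_inv hne).const_mul _
  exact (hdiv.fun_pow k).differentiableWithinAt

lemma norm_kernelPow (e : E) {h : ℝ} (h0 : 0 < h) (k : ℕ) (z : E) :
    ‖kernelPow e h k z‖ = (h / ‖1 - ((1 - h : ℝ) : ℂ) * inner ℂ e z‖) ^ k := by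
  rw [kernelPow, norm_pow, norm_div, Complex.norm_real, Real.norm_of_nonneg h0.le]

lemma norm_kernelPow_le_one {e : E} (he : ‖e‖ = 1) {h : ℝ} (h0 : 0 < h) (h1 : h ≤ 1) (k : ℕ)
    {z : E} (hz : ‖z‖ < 1) : ‖kernelPow e h k z‖ ≤ 1 := by
  rw [norm_kernelPow e h0]
  have := le_norm_one_sub_mul_inner he h1 hz
  exact pow_le_one₀ (by positivity) (div_le_one_of_le₀ this (norm_nonneg _))

/-- Here the denominator is bounded below independently of `h` at fixed `z`, which gives decay of
order `h^k` away from the sphere; this drives the pointwise convergence in the compactness argument.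
-/
lemma norm_kernelPow_le {e : E} (he : ‖e‖ = 1) {h : ℝ} (h0 : 0 < h) (h1 : h ≤ 1) (k : ℕ)
    {z : E} (hz : ‖z‖ < 1) : ‖kernelPow e h k z‖ ≤ (h / (1 - ‖z‖)) ^ k := by
  rw [norm_kernelPow e h0]
  have h2 := norm_sub_norm_le (1 : ℂ) (((1 - h : ℝ) : ℂ) * inner ℂ e z)
  have h3 := norm_inner_le_norm (𝕜 := ℂ) e z
  rw [he, one_mul] at h3
  rw [norm_one, norm_mul, Complex.norm_real, Real.norm_of_nonneg (by linarith)] at h2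
  have h4 : 1 - ‖z‖ ≤ ‖1 - ((1 - h : ℝ) : ℂ) * inner ℂ e z‖ := by
    nlinarith [norm_nonneg (inner ℂ e z : ℂ)]
  have h5 : 0 < 1 - ‖z‖ := by linarith
  gcongr

/-- With `b = ⟨z/|z|, e⟩` the denominator is `(1-b) + (1-(1-h)|z|) b`. In the window the first term
has modulus below `h` and the second at most `2h`, so the quotient is at least `1/4`. -/
lemma le_norm_kernelPow_of_mem_carlesonWindow {e : E} (he : ‖e‖ = 1) {h : ℝ} (h0 : 0 < h)
    (h1 : h ≤ 1) (k : ℕ) {z : UnitBall N} (hz : z ∈ carlesonWindow e h) :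
    1 / 4 ^ k ≤ ‖kernelPow e h k z‖ := by
  rw [mem_carlesonWindow_iff] at hz
  obtain ⟨hz0, hz1, hz2⟩ := hz
  have hz3 := le_norm_one_sub_mul_inner he h1 z.norm_lt_one
  set b : ℂ := inner ℂ e ((‖(z : E)‖⁻¹ : ℂ) • (z : E)) with hb
  have hz0' : (‖(z : E)‖ : ℂ) ≠ 0 := by exact_mod_cast norm_ne_zero_iff.2 hz0
  have hin : (inner ℂ e (z : E) : ℂ) = ‖(z : E)‖ * b := by
    rw [hb, inner_smul_right, mul_inv_cancel_left₀ hz0']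
  have hnb : ‖b‖ ≤ 1 := by
    have h := norm_inner_le_norm (𝕜 := ℂ) e ((‖(z : E)‖⁻¹ : ℂ) • (z : E))
    rwa [he, norm_smul, norm_inv, Complex.norm_real, norm_norm,
      inv_mul_cancel₀ (norm_ne_zero_iff.2 hz0), one_mul] at h
  rw [norm_kernelPow e h0, ← one_div_pow]
  refine pow_le_pow_left₀ (by norm_num) ?_ k
  rw [div_le_div_iff₀ (by norm_num) (h0.trans_le hz3), one_mul]
  have : 1 - ((1 - h : ℝ) : ℂ) * inner ℂ e (z : E) =
      (1 - b) + ((1 - (1 - h) * ‖(z : E)‖ : ℝ) : ℂ) * b := by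
    rw [hin]; push_cast; ring
  rw [this]
  refine (norm_add_le _ _).trans ?_
  have hz4 := z.norm_lt_one
  rw [norm_mul, Complex.norm_real, Real.norm_of_nonneg (by nlinarith [norm_nonneg (z : E)])]
  have : 1 - (1 - h) * ‖(z : E)‖ ≤ 2 * h := by nlinarith [norm_nonneg (z : E)]
  nlinarith [norm_nonneg b]

/-- Integral estimate for the test functions. -/
lemma exists_lintegral_kernelPow_le (hN : 1 ≤ N) {α : ℝ} (hα : -1 < α) {k : ℕ}
    (hk : (N : ℝ) + 1 + α < k) :
    ∃ C : ℝ≥0∞, C ≠ ∞ ∧ ∀ e : E, ‖e‖ = 1 → ∀ h : ℝ, 0 < h → h ≤ 1 →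
      ∫⁻ z : UnitBall N, ENNReal.ofReal ‖kernelPow e h k z‖ ∂(bergmanMeasure N α) ≤
        C * ENNReal.ofReal (h ^ ((N : ℝ) + 1 + α)) := by
  obtain ⟨C, hC, hvol⟩ := exists_bergmanMeasure_nonisotropic_le hN hα
  set p := (N : ℝ) + 1 + α with hp
  have hp0 : 0 < p := exponent_pos N hα
  -- `q` is the ratio of the dyadic series below: each shell multiplies the kernel bound by `2^(-k)`
  -- and the volume bound by `2^p`. It is less than one exactly because `k > p`.
  set q : ℝ := 2 ^ (p - k) with hq
  have hq1 : q < 1 := Real.rpow_lt_one_of_one_lt_of_neg (by norm_num) (by linarith)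
  have hq0 : 0 < q := by positivity
  refine ⟨C * ENNReal.ofReal (4 ^ p) * (1 - ENNReal.ofReal q)⁻¹, ?_, ?_⟩
  · refine ENNReal.mul_ne_top (ENNReal.mul_ne_top hC ENNReal.ofReal_ne_top) ?_
    rw [ENNReal.inv_ne_top, Ne, tsub_eq_zero_iff_le, not_le, ← ENNReal.ofReal_one]
    exact (ENNReal.ofReal_lt_ofReal_iff one_pos).2 hq1
  intro e he h h0 h1
  set S : ℕ → Set (UnitBall N) := fun j => {z | ‖1 - inner ℂ e (z : E)‖ < 2 ^ (j + 2) * h}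
    with hS
  have hSm : ∀ j, MeasurableSet (S j) := fun j =>
    (isOpen_lt (by fun_prop) continuous_const).measurableSet
  have hpt : ∀ z : UnitBall N, ENNReal.ofReal ‖kernelPow e h k z‖ ≤
      ∑' j : ℕ, (S j).indicator (fun _ => ENNReal.ofReal ((1 / 2 ^ j) ^ k)) z := by
    intro z
    have hX := le_norm_one_sub_mul_inner he h1 z.norm_lt_one
    -- `j` indexes the shell where the kernel's denominator lies in `[2^j h, 2^(j+1) h)`. Replacing
    -- `1-(1-h)⟨z,e⟩` by `1-⟨z,e⟩` costs at most `h`, hence the radius `2^(j+2) h` of `S j`.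
    obtain ⟨j, hj1, hj2⟩ := exists_nat_pow_near (one_le_div h0 |>.2 hX) (one_lt_two)
    rw [le_div_iff₀ h0] at hj1
    rw [div_lt_iff₀ h0] at hj2
    refine le_trans ?_ (ENNReal.le_tsum j)
    have hz : z ∈ S j := by
      change ‖1 - inner ℂ e (z : E)‖ < 2 ^ (j + 2) * h
      have : (1 : ℂ) - inner ℂ e (z : E) =
          (1 - ((1 - h : ℝ) : ℂ) * inner ℂ e (z : E)) - (h : ℂ) * inner ℂ e (z : E) := by
        push_cast; ring
      rw [this]
      refine (norm_sub_le _ _).trans_lt ?_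
      have h3 := norm_inner_le_norm (𝕜 := ℂ) e (z : E)
      rw [he, one_mul] at h3
      rw [norm_mul, Complex.norm_real, Real.norm_of_nonneg h0.le]
      have h4 : h * ‖inner ℂ e (z : E)‖ ≤ h := by nlinarith [z.norm_lt_one]
      have h5 : (2 : ℝ) ^ (j + 2) * h = 2 * (2 ^ (j + 1) * h) := by ring
      linarith
    rw [indicator_of_mem hz, norm_kernelPow e h0]
    apply ENNReal.ofReal_le_ofReal
    refine pow_le_pow_left₀ (by positivity) ?_ k
    rw [div_le_div_iff₀ (h0.trans_le hX) (by positivity)]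
    linarith
  calc _ ≤ ∫⁻ z : UnitBall N, ∑' j : ℕ,
        (S j).indicator (fun _ => ENNReal.ofReal ((1 / 2 ^ j) ^ k)) z ∂(bergmanMeasure N α) :=
        lintegral_mono hpt
    _ = ∑' j : ℕ, ENNReal.ofReal ((1 / 2 ^ j) ^ k) * bergmanMeasure N α (S j) := by
        rw [lintegral_tsum fun j => (measurable_const.indicator (hSm j)).aemeasurable]
        simp_rw [lintegral_indicator_const (hSm _)]
    _ ≤ ∑' j : ℕ, C * ENNReal.ofReal (4 ^ p) * ENNReal.ofReal (h ^ p) * ENNReal.ofReal q ^ j := by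
        refine ENNReal.tsum_le_tsum fun j => ?_
        refine (mul_le_mul_right (hvol e he _ (by positivity)) _).trans (le_of_eq ?_)
        have h2 : (1 / 2 ^ j) ^ k * (2 ^ (j + 2) * h) ^ p = 4 ^ p * h ^ p * q ^ j := by
          rw [Real.mul_rpow (by positivity) h0.le, pow_add, Real.mul_rpow (by positivity)
            (by norm_num), hq, ← Real.rpow_natCast (2 ^ (p - k)), ← Real.rpow_mul (by norm_num),
            ← Real.rpow_natCast 2 j, ← Real.rpow_mul (by norm_num), one_div, ← Real.rpow_neg
            (by norm_num), ← Real.rpow_natCast (2 ^ _) k, ← Real.rpow_mul (by norm_num)]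
          rw [show (p - k) * (j : ℝ) = -(j : ℝ) * k + j * p by ring,
            Real.rpow_add (by norm_num) (-(j : ℝ) * k)]
          norm_num
          ring
        rw [mul_left_comm, ← ENNReal.ofReal_mul (by positivity), h2,
          ENNReal.ofReal_mul (by positivity), ENNReal.ofReal_mul (by positivity),
          ENNReal.ofReal_pow hq0.le]
        ring
    _ = _ := by
        rw [ENNReal.tsum_mul_left, ENNReal.tsum_geometric]
        ring

end TestFunctions

/-! ### Comparing modulars and Luxemburg norms -/

section OrliczModular

variable {Ω : Type*} [MeasurableSpace Ω] {ψ : OrliczFunction} {μ : Measure Ω} {f : Ω → ℂ}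

lemma orliczModular_anti {C D : ℝ} (hC : 0 < C) (h : C ≤ D) :
    orliczModular ψ μ f D ≤ orliczModular ψ μ f C := by
  refine lintegral_mono fun z => ENNReal.ofReal_le_ofReal ?_
  have hD : 0 < D := hC.trans_le h
  refine ψ.monotoneOn (mem_Ici.2 (by positivity)) (mem_Ici.2 (by positivity)) ?_
  gcongr

lemma orliczModular_le_one_of_luxemburgNorm_lt (hf : MemOrlicz ψ μ f) {C : ℝ}
    (h : luxemburgNorm ψ μ f < C) : orliczModular ψ μ f C ≤ 1 := by
  obtain ⟨D, hD, hDC, h1⟩ := exists_lt_of_luxemburgNorm_lt hf h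
  exact (orliczModular_anti hD hDC.le).trans h1

/-- Where `|f|/(2^m C)` is at least `x₀`, apply `Δ₂` `m` times; elsewhere the integrand is at most
`ψ(2^m x₀)`, which contributes a multiple of the total mass. A norm bound thus controls the modular
at smaller scales when the measure is finite. -/
lemma OrliczFunction.DeltaTwo.exists_orliczModular_le (hψ : ψ.DeltaTwo) (m : ℕ) :
    ∃ A B : ℝ≥0∞, A ≠ ∞ ∧ B ≠ ∞ ∧ ∀ {Ω : Type} [MeasurableSpace Ω] (μ : Measure Ω) (f : Ω → ℂ)
      (C : ℝ), 0 < C →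
      orliczModular ψ μ f C ≤ A * orliczModular ψ μ f (2 ^ m * C) + B * μ univ := by
  obtain ⟨x₀, hx₀, K, hK, h⟩ := hψ.exists_map_two_pow_mul_le
  refine ⟨ENNReal.ofReal (K ^ m), ENNReal.ofReal (ψ (2 ^ m * x₀)), ENNReal.ofReal_ne_top,
    ENNReal.ofReal_ne_top, fun {Ω} _ μ f C hC => ?_⟩
  unfold orliczModular
  rw [← lintegral_const_mul' _ _ ENNReal.ofReal_ne_top, ← lintegral_const,
    ← lintegral_add_right _ measurable_const]
  refine lintegral_mono fun z => ?_
  have hx : 0 ≤ ‖f z‖ / (2 ^ m * C) := by positivity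
  have hxe : ‖f z‖ / C = 2 ^ m * (‖f z‖ / (2 ^ m * C)) := by field_simp
  rw [hxe]
  generalize ‖f z‖ / (2 ^ m * C) = x at hx
  rcases le_total x₀ x with h1 | h1
  · refine le_trans ?_ le_self_add
    rw [← ENNReal.ofReal_mul (by positivity)]
    exact ENNReal.ofReal_le_ofReal (h m x h1)
  · refine le_trans (ENNReal.ofReal_le_ofReal ?_) le_add_self
    refine ψ.monotoneOn (mem_Ici.2 (by positivity)) (mem_Ici.2 (by positivity)) ?_
    gcongr

/-- By convexity, dividing the function by `D ≥ 1` divides the modular by at least `D`: a constant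
in a modular inequality passes to the norm. -/
lemma luxemburgNorm_le_of_orliczModular_le {C D : ℝ} (hC : 0 < C) (hD : 1 ≤ D)
    (h : orliczModular ψ μ f C ≤ ENNReal.ofReal D) : luxemburgNorm ψ μ f ≤ C * D := by
  refine luxemburgNorm_le (by positivity) ((orliczModular_mul_le hC hD).trans ?_)
  calc _ ≤ ENNReal.ofReal D⁻¹ * ENNReal.ofReal D := by gcongr
    _ = 1 := by
      rw [← ENNReal.ofReal_mul (by positivity), inv_mul_cancel₀ (by positivity),
        ENNReal.ofReal_one]

end OrliczModular

/-! ### Locally uniform limits and Montel's theorem on the ball -/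

section Montel

variable {N : ℕ}

local notation "E" => EuclideanSpace ℂ (Fin N)

/-- Cauchy estimates on balls of half the radius turn uniform convergence of the functions into
uniform Cauchy convergence of the derivatives. -/
lemma DifferentiableOn.of_tendstoUniformlyOn_ball {G : ℕ → E → ℂ} {g : E → ℂ} {c : E} {δ : ℝ}
    (hδ : 0 < δ) (hG : ∀ n, DifferentiableOn ℂ (G n) (Metric.ball c δ))
    (h : TendstoUniformlyOn G g atTop (Metric.ball c δ)) : DifferentiableAt ℂ g c := by
  have hsub : ∀ x ∈ Metric.ball c (δ / 2), Metric.ball x (δ / 2) ⊆ Metric.ball c δ := by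
    intro x hx
    refine Metric.ball_subset_ball' ?_
    rw [Metric.mem_ball] at hx
    linarith
  have hGx : ∀ n, ∀ x ∈ Metric.ball c (δ / 2), DifferentiableAt ℂ (G n) x := by
    intro n x hx
    refine (hG n).differentiableAt (Metric.isOpen_ball.mem_nhds ?_)
    exact Metric.ball_subset_ball (by linarith) hx
  have hC : UniformCauchySeqOn (fun n => fderiv ℂ (G n)) atTop (Metric.ball c (δ / 2)) := by
    rw [Metric.uniformCauchySeqOn_iff]
    intro ε hε
    -- Two such errors give oscillation at most `ε δ / 4` on a ball of radius `δ / 2`, hence a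
    -- derivative bounded by `ε / 2`.
    obtain ⟨n₀, hn₀⟩ := (Metric.uniformCauchySeqOn_iff.1 h.uniformCauchySeqOn) (ε * δ / 8)
      (by positivity)
    refine ⟨n₀, fun m hm n hn x hx => ?_⟩
    have hmaps : MapsTo (fun y => G m y - G n y) (Metric.ball x (δ / 2))
        (Metric.closedBall ((fun y => G m y - G n y) x) (ε * δ / 4)) := by
      intro y hy
      have h1 := hn₀ m hm n hn y (hsub x hx hy)
      have h2 := hn₀ m hm n hn x (hsub x hx (Metric.mem_ball_self (by positivity)))
      rw [dist_eq_norm] at h1 h2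
      rw [mem_closedBall_iff_norm]
      refine (norm_sub_le _ _).trans ?_
      linarith
    have hd := Complex.norm_fderiv_le_div_of_mapsTo_ball
      (((hG m).mono (hsub x hx)).fun_sub ((hG n).mono (hsub x hx))) hmaps (by positivity)
    rw [fderiv_fun_sub (hGx m x hx) (hGx n x hx)] at hd
    rw [dist_eq_norm]
    refine hd.trans_lt ?_
    rw [div_lt_iff₀ (by positivity)]
    nlinarith [mul_pos hε hδ]
  -- The implication is placed inside the existential so that the limits can be chosen for all `x`;
  -- outside the small ball the value is irrelevant.
  have hlim : ∀ x, ∃ L, x ∈ Metric.ball c (δ / 2) →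
      Tendsto (fun n => fderiv ℂ (G n) x) atTop (𝓝 L) := by
    intro x
    by_cases hx : x ∈ Metric.ball c (δ / 2)
    · obtain ⟨L, hL⟩ := cauchySeq_tendsto_of_complete (hC.cauchySeq hx)
      exact ⟨L, fun _ => hL⟩
    · exact ⟨0, fun h => absurd h hx⟩
  choose g' hg' using hlim
  have hunif := hC.tendstoUniformlyOn_of_tendsto hg'
  have hc : c ∈ Metric.ball c (δ / 2) := Metric.mem_ball_self (by positivity)
  refine (hasFDerivAt_of_tendstoUniformlyOn Metric.isOpen_ball hunif
    (fun n x hx => (hGx n x hx).hasFDerivAt) (fun x hx => ?_) hc).differentiableAt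
  exact h.tendsto_at (Metric.ball_subset_ball (by linarith) hx)

/-- A locally uniform limit of holomorphic functions on the ball is holomorphic. -/
lemma IsHolomorphic.of_tendstoLocallyUniformly {F : ℕ → UnitBall N → ℂ} {f : UnitBall N → ℂ}
    (hF : ∀ n, IsHolomorphic (F n)) (h : TendstoLocallyUniformly F f atTop) :
    IsHolomorphic f := by
  choose G hG hGF using hF
  classical
  refine ⟨fun z => if hz : z ∈ Metric.ball (0 : E) 1 then f ⟨z, hz⟩ else 0, ?_,
    fun z => dif_pos z.2⟩
  intro c hc
  have : LocallyCompactSpace (UnitBall N) := Metric.isOpen_ball.locallyCompactSpace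
  have : ∃ s ∈ 𝓝 (⟨c, hc⟩ : UnitBall N), TendstoUniformlyOn F f atTop s := by
    obtain ⟨s, hs, hs'⟩ := exists_compact_mem_nhds (⟨c, hc⟩ : UnitBall N)
    exact ⟨s, hs', tendstoLocallyUniformly_iff_forall_isCompact.1 h s hs⟩
  obtain ⟨s, hs, hunif⟩ := this
  obtain ⟨ε, hε, hεs⟩ := Metric.mem_nhds_iff.1 hs
  obtain ⟨ε', hε', hball⟩ := Metric.isOpen_iff.1 Metric.isOpen_ball c hc
  set δ := min ε ε' with hδ
  have hδ0 : 0 < δ := lt_min hε hε'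
  have hsub : Metric.ball c δ ⊆ Metric.ball (0 : E) 1 :=
    (Metric.ball_subset_ball (min_le_right _ _)).trans hball
  refine (DifferentiableOn.of_tendstoUniformlyOn_ball hδ0 (fun n => (hG n).mono hsub)
    ?_).differentiableWithinAt
  rw [Metric.tendstoUniformlyOn_iff] at hunif ⊢
  intro η hη
  filter_upwards [hunif η hη] with n hn x hx
  have hx1 := hsub hx
  have := hn ⟨x, hx1⟩ (hεs (Metric.ball_subset_ball (min_le_left ε ε') hx))
  rw [dif_pos hx1, hGF n ⟨x, hx1⟩]
  exact this

/-- **Montel's theorem** on the unit ball. -/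
lemma exists_subseq_tendstoLocallyUniformly {F : ℕ → UnitBall N → ℂ}
    (hF : ∀ n, IsHolomorphic (F n))
    (hbd : ∀ R < 1, ∃ M, ∀ n, ∀ z : UnitBall N, ‖(z : E)‖ ≤ R → ‖F n z‖ ≤ M) :
    ∃ (f : UnitBall N → ℂ) (θ : ℕ → ℕ), StrictMono θ ∧ IsHolomorphic f ∧
      TendstoLocallyUniformly (fun n => F (θ n)) f atTop := by
  choose! M hM using hbd
  choose G hG hGF using hF
  -- Half the distance to the sphere: the ball of radius `δ z` about `z` lies in `‖·‖ ≤ (1+‖z‖)/2`,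
  -- where the sequence is uniformly bounded by `B z`.
  set δ : UnitBall N → ℝ := fun z => (1 - ‖(z : E)‖) / 2 with hδ
  have hδ0 : ∀ z, 0 < δ z := fun z => by have := z.norm_lt_one; simp only [hδ]; linarith
  set B : UnitBall N → ℝ := fun z => M ((1 + ‖(z : E)‖) / 2) with hB
  have hMB : ∀ n (z₀ z : UnitBall N), dist z z₀ < δ z₀ → ‖F n z‖ ≤ B z₀ := by
    intro n z₀ z hz
    have := z₀.norm_lt_one
    refine hM _ (by linarith) n z ?_
    rw [Subtype.dist_eq, dist_eq_norm] at hz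
    have := norm_le_norm_add_norm_sub' (z : E) z₀
    simp only [hδ] at hz
    linarith
  have hlip : ∀ n (z₀ z : UnitBall N), dist z z₀ < δ z₀ →
      dist (F n z) (F n z₀) ≤ 2 * B z₀ / δ z₀ * dist z z₀ := by
    intro n z₀ z hz
    have hsub : Metric.ball (z₀ : E) (δ z₀) ⊆ Metric.ball 0 1 := by
      refine Metric.ball_subset_ball' ?_
      have := z₀.norm_lt_one
      rw [dist_zero_right]
      simp only [hδ]
      linarith
    have hmaps : MapsTo (G n) (Metric.ball (z₀ : E) (δ z₀))
        (Metric.closedBall (G n z₀) (2 * B z₀)) := by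
      intro x hx
      have h1 := hMB n z₀ ⟨x, hsub hx⟩ hx
      have h2 := hMB n z₀ z₀ (by rw [dist_self]; exact hδ0 z₀)
      rw [← hGF] at h1 h2
      rw [mem_closedBall_iff_norm]
      refine (norm_sub_le _ _).trans ?_
      linarith
    have := Complex.dist_le_div_mul_dist_of_mapsTo_ball ((hG n).mono hsub) hmaps
      (z := (z : E)) hz
    rwa [hGF, hGF] at this
  -- The pointwise bounds and the local Lipschitz bounds from the Schwarz lemma are closed
  -- conditions for pointwise convergence, so `T` is compact by Tychonoff; it is also
  -- equicontinuous. Arzelà–Ascoli then upgrades this to locally uniform compactness.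
  set T : Set (UnitBall N → ℂ) := {f | (∀ z, f z ∈ Metric.closedBall 0 (B z)) ∧
    ∀ z₀ z, dist z z₀ < δ z₀ → dist (f z) (f z₀) ≤ 2 * B z₀ / δ z₀ * dist z z₀} with hT
  have hTc : IsCompact T := by
    refine (isCompact_univ_pi fun z : UnitBall N =>
      ProperSpace.isCompact_closedBall (0 : ℂ) (B z)).of_isClosed_subset ?_ ?_
    · have : T = (⋂ z, {f | f z ∈ Metric.closedBall 0 (B z)}) ∩ ⋂ z₀, ⋂ z,
          {f | dist z z₀ < δ z₀ → dist (f z) (f z₀) ≤ 2 * B z₀ / δ z₀ * dist z z₀} := by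
        ext f; simp [hT]
      rw [this]
      refine (isClosed_iInter fun z => ?_).inter (isClosed_iInter fun z₀ => isClosed_iInter
        fun z => ?_)
      · exact Metric.isClosed_closedBall.preimage (continuous_apply z)
      · by_cases hz : dist z z₀ < δ z₀
        · simp only [hz, true_imp_iff]
          exact isClosed_le (by fun_prop) continuous_const
        · simp [hz]
    · exact fun f hf z _ => hf.1 z
  have hEq : Equicontinuous ((↑) : T → UnitBall N → ℂ) := by
    intro z₀
    refine Metric.equicontinuousAt_of_continuity_modulus
      (fun z => 2 * B z₀ / δ z₀ * dist z z₀) ?_ _ ?_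
    · have : Continuous fun z : UnitBall N => 2 * B z₀ / δ z₀ * dist z z₀ := by fun_prop
      simpa using this.tendsto z₀
    · filter_upwards [Metric.ball_mem_nhds z₀ (hδ0 z₀)] with z hz f
      rw [dist_comm]
      exact f.2.2 z₀ z hz
  set S : Set C(UnitBall N, ℂ) := {f | ⇑f ∈ T} with hS
  have himg : ContinuousMap.toFun '' S = T := by
    ext f
    refine ⟨?_, fun hf => ⟨⟨f, hEq.continuous ⟨f, hf⟩⟩, hf, rfl⟩⟩
    rintro ⟨g, hg, rfl⟩
    exact hg
  have : LocallyCompactSpace (UnitBall N) := Metric.isOpen_ball.locallyCompactSpace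
  have hSc : IsCompact S := by
    refine ArzelaAscoli.isCompact_of_equicontinuous S (himg ▸ hTc) ?_
    exact hEq.comp (fun f : S => (⟨f.1, f.2⟩ : T))
  let Fc : ℕ → C(UnitBall N, ℂ) := fun n =>
    ⟨F n, IsHolomorphic.continuous ⟨G n, hG n, hGF n⟩⟩
  have hFS : ∀ n, Fc n ∈ S := fun n =>
    ⟨fun z => mem_closedBall_zero_iff.2 (hMB n z z (by rw [dist_self]; exact hδ0 z)),
      fun z₀ z => hlip n z₀ z⟩
  obtain ⟨f, -, θ, hθ, hlim⟩ := hSc.isSeqCompact hFS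
  rw [ContinuousMap.tendsto_iff_tendstoLocallyUniformly] at hlim
  exact ⟨f, θ, hθ, IsHolomorphic.of_tendstoLocallyUniformly
    (fun n => ⟨G (θ n), hG (θ n), hGF (θ n)⟩) hlim, hlim⟩

end Montel

/-! ### Point evaluations and sequential compactness of the unit ball -/

namespace BergmanOrlicz

variable {N : ℕ} {α : ℝ} {hα : -1 < α} {ψ : OrliczFunction}

local notation "E" => EuclideanSpace ℂ (Fin N)

/-- The element of the Bergman-Orlicz space with underlying function `f`. -/
def mk (f : UnitBall N → ℂ) (h1 : IsHolomorphic f) (h2 : MemOrlicz ψ (bergmanMeasure N α) f) :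
    BergmanOrlicz N α hα ψ :=
  (⟨f, h1, h2⟩ : bergmanOrliczSubmodule N α ψ)

lemma ext {f g : BergmanOrlicz N α hα ψ} (h : ∀ z, f z = g z) : f = g :=
  Subtype.ext (funext h)

lemma sub_apply (f g : BergmanOrlicz N α hα ψ) (z : UnitBall N) : (f - g) z = f z - g z := rfl

lemma zero_apply (z : UnitBall N) : (0 : BergmanOrlicz N α hα ψ) z = 0 := rfl

lemma orliczModular_le_one {f : BergmanOrlicz N α hα ψ} {C : ℝ} (h : ‖f‖ < C) :
    orliczModular ψ (bergmanMeasure N α) f C ≤ 1 :=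
  orliczModular_le_one_of_luxemburgNorm_lt f.memOrlicz h

/-- Point evaluations are bounded, uniformly on compact subsets of the ball. -/
lemma exists_norm_apply_le (hN : 1 ≤ N) (hα : -1 < α) (ψ : OrliczFunction) {R : ℝ} (hR : R < 1) :
    ∃ X : ℝ, ∀ (f : BergmanOrlicz N α hα ψ) (z : UnitBall N), ‖(z : E)‖ ≤ R →
      ‖f z‖ ≤ X * ‖f‖ := by
  obtain ⟨C, hC, hmv⟩ := exists_map_norm_le_lintegral_isNear hN hα
  set p := (N : ℝ) + 1 + α with hp
  have hp0 : 0 < p := exponent_pos N hα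
  have hR0 : 0 < 1 - R := by linarith
  -- The `+ 1` makes `ψ X` strictly larger than the mean value bound, so that monotonicity of `ψ`
  -- can be inverted.
  obtain ⟨X, hX0, hX⟩ := ψ.exists_map_eq (A := C.toReal / (1 - R) ^ p + 1) (by positivity)
  refine ⟨X, fun f z hz => ?_⟩
  obtain ⟨F, hF, hFf⟩ := f.isHolomorphic
  have key : ∀ c : ℝ, ‖f‖ < c → ‖f z‖ ≤ X * c := by
    intro c hc
    have hc0 : 0 < c := (norm_nonneg f).trans_lt hc
    have h := hmv ψ F hF c hc0 z
    have h2 : C * ∫⁻ w : UnitBall N, {w : E | IsNear (z : E) w}.indicator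
        (fun w => ENNReal.ofReal (ψ (‖F w‖ / c))) w ∂(bergmanMeasure N α) ≤ C * 1 := by
      refine mul_le_mul_right (le_trans (lintegral_mono fun w => ?_) (orliczModular_le_one hc)) _
      exact (indicator_le_self' (fun _ _ => zero_le) _).trans (by rw [hFf w])
    have h3 := h.trans h2
    have hz0 : 0 < 1 - ‖(z : E)‖ := by linarith [z.norm_lt_one]
    rw [mul_one, ← ENNReal.ofReal_toReal hC, ← ENNReal.ofReal_mul (by positivity),
      ENNReal.ofReal_le_ofReal_iff ENNReal.toReal_nonneg, hFf z] at h3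
    have h4 : (1 - R) ^ p * ψ (‖f z‖ / c) ≤ C.toReal := by
      refine le_trans ?_ h3
      have := ψ.nonneg' (‖f z‖ / c) (by positivity)
      gcongr
    have h5 : ψ (‖f z‖ / c) < ψ X := by
      rw [hX]
      have : ψ (‖f z‖ / c) ≤ C.toReal / (1 - R) ^ p := by
        rwa [le_div_iff₀' (by positivity)]
      linarith
    have h6 := ψ.lt_of_map_lt (by positivity) hX0 h5
    exact ((div_lt_iff₀ hc0).1 h6).le
  -- The modular is known to be at most one only for `c > ‖f‖`; the bound at `‖f‖` itself is
  -- obtained as a limit.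
  have hlim : Tendsto (fun c => X * c) (𝓝[>] ‖f‖) (𝓝 (X * ‖f‖)) :=
    (tendsto_nhdsWithin_of_tendsto_nhds (continuous_const_mul X).continuousAt)
  exact ge_of_tendsto hlim (by filter_upwards [self_mem_nhdsWithin] with c hc using key c hc)

/-- Norm convergence implies pointwise convergence. -/
lemma tendsto_apply (hN : 1 ≤ N) {f : ℕ → BergmanOrlicz N α hα ψ} {g : BergmanOrlicz N α hα ψ}
    (h : Tendsto f atTop (𝓝 g)) (z : UnitBall N) : Tendsto (fun n => f n z) atTop (𝓝 (g z)) := by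
  obtain ⟨X, hX⟩ := exists_norm_apply_le hN hα ψ z.norm_lt_one
  rw [tendsto_iff_norm_sub_tendsto_zero] at h ⊢
  refine squeeze_zero (fun _ => norm_nonneg _) (fun n => ?_) (by simpa using h.const_mul X)
  rw [← sub_apply]
  exact hX _ z le_rfl

/-- The closed unit ball is sequentially compact for locally uniform convergence. -/
lemma exists_subseq_tendstoLocallyUniformly (hN : 1 ≤ N) {f : ℕ → BergmanOrlicz N α hα ψ}
    (hf : ∀ n, ‖f n‖ ≤ 1) : ∃ (g : BergmanOrlicz N α hα ψ) (θ : ℕ → ℕ), StrictMono θ ∧ ‖g‖ ≤ 1 ∧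
      TendstoLocallyUniformly (fun n => (f (θ n) : UnitBall N → ℂ)) g atTop := by
  obtain ⟨g, θ, hθ, hg, hlim⟩ := _root_.exists_subseq_tendstoLocallyUniformly
    (F := fun n => (f n : UnitBall N → ℂ)) (fun n => (f n).isHolomorphic) (fun R hR => by
      obtain ⟨X, hX⟩ := exists_norm_apply_le hN hα ψ hR
      refine ⟨|X|, fun n z hz => (hX (f n) z hz).trans ?_⟩
      calc X * ‖f n‖ ≤ |X| * 1 := by gcongr; exacts [le_abs_self X, hf n]
        _ = |X| := mul_one _)
  -- Fatou's lemma: the limit again has modular at most one at every scale `c > 1`, hence norm at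
  -- most one.
  have hmod : ∀ c : ℝ, 1 < c → orliczModular ψ (bergmanMeasure N α) g c ≤ 1 := by
    intro c hc
    have hc0 : 0 < c := by linarith
    have hpt : ∀ z, Tendsto (fun n => ENNReal.ofReal (ψ (‖f (θ n) z‖ / c))) atTop
        (𝓝 (ENNReal.ofReal (ψ (‖g z‖ / c)))) := by
      intro z
      have h1 : Tendsto (fun n => ‖f (θ n) z‖ / c) atTop (𝓝 (‖g z‖ / c)) :=
        ((hlim.tendstoLocallyUniformlyOn (s := univ)).tendsto_at (mem_univ z)).norm.div_const c
      have h2 := (ψ.continuousOn (‖g z‖ / c) (mem_Ici.2 (by positivity))).tendsto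
      refine ENNReal.tendsto_ofReal (h2.comp (tendsto_nhdsWithin_iff.2 ⟨h1, ?_⟩))
      exact Eventually.of_forall fun n => mem_Ici.2 (by positivity)
    unfold orliczModular
    simp_rw [fun z => (hpt z).liminf_eq.symm]
    refine (lintegral_liminf_le' fun n => ψ.measurable_comp_norm
      (f (θ n)).memOrlicz.1 c hc0).trans ?_
    refine liminf_le_of_le (by isBoundedDefault) fun b hb => ?_
    obtain ⟨n, hn⟩ := hb.exists
    exact hn.trans (orliczModular_le_one ((hf _).trans_lt hc))
  have hmem : MemOrlicz ψ (bergmanMeasure N α) g :=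
    ⟨hg.continuous.measurable.aemeasurable, 2, two_pos,
      (hmod 2 one_lt_two).trans_lt ENNReal.one_lt_top⟩
  refine ⟨mk g hg hmem, θ, hθ, ?_, hlim⟩
  refine le_of_forall_gt_imp_ge_of_dense fun c hc => ?_
  exact luxemburgNorm_le (by linarith) (hmod c hc)

end BergmanOrlicz

/-! ### Embedding theorems for Carleson and vanishing Carleson measures -/

section CarlesonMeasures

variable {N : ℕ} {α : ℝ} {μ : Measure (UnitBall N)}

local notation "E" => EuclideanSpace ℂ (Fin N)

lemma carlesonRho_le_of_div_le {t : ℝ} (ht : 0 < t) {κ : ℝ≥0∞}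
    (h : carlesonRho μ t / ENNReal.ofReal (t ^ ((N : ℝ) + 1 + α)) ≤ κ) :
    carlesonRho μ t ≤ κ * ENNReal.ofReal (t ^ ((N : ℝ) + 1 + α)) := by
  rwa [ENNReal.div_le_iff_le_mul (Or.inl (ENNReal.ofReal_pos.2 (by positivity)).ne')
    (Or.inl ENNReal.ofReal_ne_top)] at h

lemma IsBergmanCarleson.carlesonRho_le (h : IsBergmanCarleson μ α) :
    ∃ κ : ℝ≥0∞, κ ≠ ∞ ∧ ∀ t ∈ Ioc (0 : ℝ) 1,
      carlesonRho μ t ≤ κ * ENNReal.ofReal (t ^ ((N : ℝ) + 1 + α)) := by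
  obtain ⟨C, hC⟩ := h
  refine ⟨C, ENNReal.coe_ne_top, fun t ht => carlesonRho_le_of_div_le ht.1 ?_⟩
  refine le_trans ?_ (hC 1 ⟨one_pos, le_rfl⟩)
  exact le_iSup₂ (f := fun t (_ : t ∈ Ioc (0 : ℝ) 1) =>
    carlesonRho μ t / ENNReal.ofReal (t ^ ((N : ℝ) + 1 + α))) t ht

lemma carlesonRho_le_univ (t : ℝ) : carlesonRho μ t ≤ μ univ :=
  iSup₂_le fun _ _ => measure_mono (subset_univ _)

/-- For finite measures the Carleson condition only has to be checked for small windows. -/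
lemma isBergmanCarleson_of_carlesonRho_le [IsFiniteMeasure μ] (hα : -1 < α) {δ : ℝ} (hδ : 0 < δ)
    {κ : ℝ≥0∞} (hκt : κ ≠ ∞) (hκ : ∀ t ∈ Ioo (0 : ℝ) δ,
      carlesonRho μ t ≤ κ * ENNReal.ofReal (t ^ ((N : ℝ) + 1 + α))) :
    IsBergmanCarleson μ α := by
  have hp := exponent_pos N hα
  set p := (N : ℝ) + 1 + α with hpdef
  have hC : κ + μ univ * ENNReal.ofReal (δ⁻¹ ^ p) ≠ ∞ := ENNReal.add_ne_top.2
    ⟨hκt, ENNReal.mul_ne_top (measure_ne_top _ _) ENNReal.ofReal_ne_top⟩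
  refine ⟨(κ + μ univ * ENNReal.ofReal (δ⁻¹ ^ p)).toNNReal, fun h _ => ?_⟩
  rw [ENNReal.coe_toNNReal hC]
  refine iSup₂_le fun t ht => ENNReal.div_le_of_le_mul ?_
  rw [add_mul]
  rcases lt_or_ge t δ with h1 | h1
  · exact (hκ t ⟨ht.1, h1⟩).trans le_self_add
  -- Large windows are controlled by the total mass, as `(t/δ)^p ≥ 1`.
  · refine le_trans ?_ le_add_self
    refine (carlesonRho_le_univ t).trans ?_
    rw [mul_assoc, ← ENNReal.ofReal_mul (by positivity), ← Real.mul_rpow (by positivity) ht.1.le]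
    refine le_mul_of_one_le_right zero_le ?_
    rw [← ENNReal.ofReal_one]
    refine ENNReal.ofReal_le_ofReal (Real.one_le_rpow ?_ hp.le)
    rwa [inv_mul_eq_div, one_le_div hδ]

lemma IsVanishingBergmanCarleson.exists_carlesonRho_le (h : IsVanishingBergmanCarleson μ α)
    {κ : ℝ≥0∞} (hκ : 0 < κ) : ∃ δ > (0 : ℝ), ∀ t ∈ Ioo (0 : ℝ) δ,
      carlesonRho μ t ≤ κ * ENNReal.ofReal (t ^ ((N : ℝ) + 1 + α)) := by
  obtain ⟨δ, hδ, hsub⟩ := mem_nhdsGT_iff_exists_Ioo_subset.1 (h.eventually (gt_mem_nhds hκ))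
  exact ⟨δ, hδ, fun t ht => carlesonRho_le_of_div_le ht.1 (hsub ht).le⟩

lemma IsVanishingBergmanCarleson.isBergmanCarleson [IsFiniteMeasure μ] (hα : -1 < α)
    (h : IsVanishingBergmanCarleson μ α) : IsBergmanCarleson μ α := by
  obtain ⟨δ, hδ, hκ⟩ := h.exists_carlesonRho_le one_pos
  exact isBergmanCarleson_of_carlesonRho_le hα hδ ENNReal.one_ne_top hκ

/-- Carleson measures embed Bergman-Orlicz modulars. -/
lemma IsBergmanCarleson.exists_lintegral_le [IsFiniteMeasure μ] (hN : 1 ≤ N) (hα : -1 < α)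
    (h : IsBergmanCarleson μ α) : ∃ D : ℝ≥0∞, D ≠ ∞ ∧ ∀ (ψ : OrliczFunction) (f : UnitBall N → ℂ),
      IsHolomorphic f → ∀ c : ℝ, 0 < c →
      orliczModular ψ μ f c ≤ D * orliczModular ψ (bergmanMeasure N α) f c := by
  obtain ⟨C, hC, hemb⟩ := exists_lintegral_le_of_measure_isNear_le hN hα
  obtain ⟨κ, hκt, hκ⟩ := h.carlesonRho_le
  have hp := exponent_pos N hα
  set p := (N : ℝ) + 1 + α with hpdef
  refine ⟨C * ((κ + μ univ) * ENNReal.ofReal (21 ^ p)), ?_, ?_⟩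
  · exact ENNReal.mul_ne_top hC (ENNReal.mul_ne_top (ENNReal.add_ne_top.2
      ⟨hκt, measure_ne_top _ _⟩) ENNReal.ofReal_ne_top)
  rintro ψ f ⟨F, hF, hFf⟩ c hc
  have := hemb μ ((κ + μ univ) * ENNReal.ofReal (21 ^ p)) (fun w => ?_) ψ F hF c hc
  · simp_rw [hFf] at this
    exact this
  have hs0 : 0 < 1 - ‖(w : E)‖ ^ 2 := one_sub_norm_sq_pos w.norm_lt_one
  rw [add_mul, add_mul]
  rcases le_or_gt (21 * (1 - ‖(w : E)‖ ^ 2)) 1 with h1 | h1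
  · exact (measure_isNear_le_of_carlesonRho_le le_rfl hκ w h1).trans le_self_add
  · refine le_trans ?_ le_add_self
    refine (measure_mono (subset_univ _)).trans ?_
    rw [mul_assoc, ← ENNReal.ofReal_mul (by positivity), ← Real.mul_rpow (by positivity) hs0.le]
    refine le_mul_of_one_le_right zero_le ?_
    rw [← ENNReal.ofReal_one]
    exact ENNReal.ofReal_le_ofReal (Real.one_le_rpow h1.le hp.le)

/-- For a vanishing Carleson measure, the embedding constant near the boundary is small. -/
lemma IsVanishingBergmanCarleson.exists_lintegral_le [IsFiniteMeasure μ] (hN : 1 ≤ N)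
    (hα : -1 < α) (h : IsVanishingBergmanCarleson μ α) {η : ℝ≥0∞} (hη : 0 < η) :
    ∃ R < (1 : ℝ), ∀ (ψ : OrliczFunction) (f : UnitBall N → ℂ),
      IsHolomorphic f → ∀ c : ℝ, 0 < c →
      orliczModular ψ (μ.restrict {z | R < ‖(z : E)‖}) f c ≤
        η * orliczModular ψ (bergmanMeasure N α) f c := by
  obtain ⟨C, hC, hemb⟩ := exists_lintegral_le_of_measure_isNear_le hN hα
  set p := (N : ℝ) + 1 + α with hpdef
  obtain ⟨κ, hκ0, hκ⟩ := ENNReal.exists_nnreal_pos_mul_lt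
    (ENNReal.mul_ne_top hC (ENNReal.ofReal_ne_top (r := 21 ^ p))) hη.ne'
  obtain ⟨δ, hδ, hρ⟩ := h.exists_carlesonRho_le (κ := (κ : ℝ≥0∞)) (by exact_mod_cast hκ0)
  -- The smallness of `ϱ_μ` is known on an open interval; `δ / 2` makes the right endpoint
  -- admissible.
  set δ' := min 1 (δ / 2) with hδ'
  have hδ0 : 0 < δ' := lt_min one_pos (by positivity)
  -- `126 = 21 * 6`: by the comparison `1-‖w‖² < 6(1-‖z‖)`, a point `z` this close to the sphere is
  -- near only those `w` with `21(1-‖w‖²) < δ'`. For every other `w` the restricted measure of the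
  -- set near `w` is zero.
  refine ⟨1 - δ' / 126, by linarith, ?_⟩
  rintro ψ f ⟨F, hF, hFf⟩ c hc
  have hSm : MeasurableSet {z : UnitBall N | 1 - δ' / 126 < ‖(z : E)‖} :=
    (isOpen_lt continuous_const (by fun_prop)).measurableSet
  have := hemb (μ.restrict {z | 1 - δ' / 126 < ‖(z : E)‖}) (κ * ENNReal.ofReal (21 ^ p))
    (fun w => ?_) ψ F hF c hc
  · simp_rw [hFf] at this
    refine this.trans (mul_le_mul_left ?_ _)
    rw [mul_left_comm]
    exact hκ.le
  rw [Measure.restrict_apply' hSm]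
  rcases le_or_gt (21 * (1 - ‖(w : E)‖ ^ 2)) δ' with h1 | h1
  · refine (measure_mono inter_subset_left).trans ?_
    refine measure_isNear_le_of_carlesonRho_le (min_le_left _ _) (fun t ht => hρ t ⟨ht.1, ?_⟩) w h1
    have := ht.2.trans (min_le_right _ _)
    linarith
  · have : {z : UnitBall N | IsNear (z : E) w} ∩ {z | 1 - δ' / 126 < ‖(z : E)‖} = ∅ := by
      ext z
      simp only [mem_inter_iff, mem_ofPred_eq, mem_empty_iff_false, iff_false, not_and, not_lt]
      intro hz
      have := hz.one_sub_norm_sq_lt z.norm_lt_one w.norm_lt_one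
      linarith
    rw [this, measure_empty]
    exact zero_le

end CarlesonMeasures

/-! ### Sufficiency: boundedness and compactness of the composition operator -/

section Composition

variable {N : ℕ} {α : ℝ} {hα : -1 < α} {ψ : OrliczFunction} {ϕ : UnitBall N → UnitBall N}

local notation "E" => EuclideanSpace ℂ (Fin N)

lemma continuous_of_isHolomorphic_coe (hϕ : IsHolomorphic fun z => (ϕ z : E)) : Continuous ϕ :=
  continuous_induced_rng.2 hϕ.continuous

lemma IsHolomorphic.comp_self {f : UnitBall N → ℂ} (hf : IsHolomorphic f)
    (hϕ : IsHolomorphic fun z => (ϕ z : E)) : IsHolomorphic fun z => f (ϕ z) := by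
  obtain ⟨F, hF, hFf⟩ := hf
  obtain ⟨Φ, hΦ, hΦϕ⟩ := hϕ
  refine ⟨F ∘ Φ, hF.comp hΦ fun z hz => ?_, fun z => ?_⟩
  · have := hΦϕ ⟨z, hz⟩
    rw [show Φ z = _ from this]
    exact (ϕ ⟨z, hz⟩).2
  · rw [Function.comp_apply, hΦϕ, hFf]

lemma orliczModular_comp (hϕ : IsHolomorphic fun z => (ϕ z : E)) {f : UnitBall N → ℂ}
    (hf : IsHolomorphic f) {c : ℝ} (hc : 0 < c) :
    orliczModular ψ (bergmanMeasure N α) (fun z => f (ϕ z)) c =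
      orliczModular ψ (pullbackMeasure N α ϕ) f c :=
  (lintegral_map' (ψ.measurable_comp_norm hf.continuous.measurable.aemeasurable c hc)
    (continuous_of_isHolomorphic_coe hϕ).measurable.aemeasurable).symm

lemma memOrlicz_comp (hN : 1 ≤ N) (hα : -1 < α) (hϕ : IsHolomorphic fun z => (ϕ z : E))
    [IsFiniteMeasure (pullbackMeasure N α ϕ)] (h : IsBergmanCarleson (pullbackMeasure N α ϕ) α)
    (f : BergmanOrlicz N α hα ψ) : MemOrlicz ψ (bergmanMeasure N α) (fun z => f (ϕ z)) := by
  obtain ⟨D, hD, hemb⟩ := h.exists_lintegral_le hN hα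
  obtain ⟨-, c, hc, hfc⟩ := f.memOrlicz
  refine ⟨(f.isHolomorphic.comp_self hϕ).continuous.measurable.aemeasurable, c, hc, ?_⟩
  rw [orliczModular_comp hϕ f.isHolomorphic hc]
  exact (hemb ψ f f.isHolomorphic c hc).trans_lt (ENNReal.mul_lt_top hD.lt_top hfc)

/-- The composition operator, as a linear map, when it is well defined. -/
def compositionLinearMap (hϕ : IsHolomorphic fun z => (ϕ z : E))
    (h : ∀ f : BergmanOrlicz N α hα ψ, MemOrlicz ψ (bergmanMeasure N α) (fun z => f (ϕ z))) :
    BergmanOrlicz N α hα ψ →ₗ[ℂ] BergmanOrlicz N α hα ψ where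
  toFun f := BergmanOrlicz.mk (fun z => f (ϕ z)) (f.isHolomorphic.comp_self hϕ) (h f)
  map_add' _ _ := rfl
  map_smul' _ _ := rfl

lemma compositionBounded_of_isBergmanCarleson (hN : 1 ≤ N) (hα : -1 < α)
    (hϕ : IsHolomorphic fun z => (ϕ z : E)) [IsFiniteMeasure (pullbackMeasure N α ϕ)]
    (h : IsBergmanCarleson (pullbackMeasure N α ϕ) α) : CompositionBounded N α hα ψ ϕ := by
  obtain ⟨D, hD, hemb⟩ := h.exists_lintegral_le hN hα
  set D' := max 1 D.toReal with hD'
  have hD1 : 1 ≤ D' := le_max_left _ _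
  refine ⟨(compositionLinearMap hϕ (memOrlicz_comp hN hα hϕ h)).mkContinuous D' fun f => ?_,
    fun f z => rfl⟩
  have key : ∀ c, ‖f‖ < c → ‖compositionLinearMap hϕ (memOrlicz_comp hN hα hϕ h) f‖ ≤ c * D' := by
    intro c hc
    have hc0 : 0 < c := (norm_nonneg f).trans_lt hc
    refine luxemburgNorm_le_of_orliczModular_le hc0 hD1 ?_
    refine (orliczModular_comp hϕ f.isHolomorphic hc0).trans_le ?_
    refine (hemb ψ f f.isHolomorphic c hc0).trans ?_
    calc D * orliczModular ψ (bergmanMeasure N α) f c ≤ D * 1 :=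
          mul_le_mul_right (BergmanOrlicz.orliczModular_le_one hc) _
      _ = ENNReal.ofReal D.toReal := by rw [mul_one, ENNReal.ofReal_toReal hD]
      _ ≤ _ := ENNReal.ofReal_le_ofReal (le_max_right _ _)
  have hlim : Tendsto (fun c => c * D') (𝓝[>] ‖f‖) (𝓝 (‖f‖ * D')) :=
    tendsto_nhdsWithin_of_tendsto_nhds (continuous_mul_const D').continuousAt
  rw [mul_comm D']
  exact ge_of_tendsto hlim (by filter_upwards [self_mem_nhdsWithin] with c hc using key c hc)

lemma isCompact_norm_le {R : ℝ} (hR : R < 1) : IsCompact {z : UnitBall N | ‖(z : E)‖ ≤ R} := by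
  have h : Subtype.val '' {z : UnitBall N | ‖(z : E)‖ ≤ R} = Metric.closedBall (0 : E) R := by
    ext z
    rw [mem_closedBall_zero_iff]
    refine ⟨?_, fun hz => ⟨⟨z, mem_ball_zero_iff.2 (hz.trans_lt hR)⟩, hz, rfl⟩⟩
    rintro ⟨w, hw, rfl⟩
    exact hw
  rw [Subtype.isCompact_iff, h]
  exact isCompact_closedBall (0 : E) R

/-- Given a locally uniformly convergent sequence in the unit ball, split the modular of the
difference at radius `R`. Outside, a small embedding constant multiplies a modular kept bounded by
`Δ₂`; inside, uniform convergence makes the integrand small. Each part is at most `1/2`, so the norm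
of the image is at most `ε`. -/
lemma compositionCompact_of_isVanishingBergmanCarleson (hN : 1 ≤ N) (hα : -1 < α)
    (hψ : ψ.DeltaTwo) (hϕ : IsHolomorphic fun z => (ϕ z : E))
    [IsFiniteMeasure (bergmanMeasure N α)] [IsFiniteMeasure (pullbackMeasure N α ϕ)]
    (h : IsVanishingBergmanCarleson (pullbackMeasure N α ϕ) α) :
    CompositionCompact N α hα ψ ϕ := by
  set μ := pullbackMeasure N α ϕ with hμ
  set T := compositionLinearMap hϕ (memOrlicz_comp (ψ := ψ) hN hα hϕ (h.isBergmanCarleson hα))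
  refine ⟨T, fun f z => rfl, ?_⟩
  rw [isCompactOperator_iff_image_closedBall_subset_compact T one_pos]
  -- The image of the closed unit ball is itself sequentially compact, because the locally uniform
  -- limit `g` also belongs to that ball.
  refine ⟨T '' Metric.closedBall 0 1, IsSeqCompact.isCompact ?_, subset_rfl⟩
  intro y hy
  choose f hf hfy using hy
  obtain ⟨g, θ, hθ, hg, hlim⟩ := BergmanOrlicz.exists_subseq_tendstoLocallyUniformly hN
    fun n => mem_closedBall_zero_iff.1 (hf n)
  refine ⟨T g, ⟨g, mem_closedBall_zero_iff.2 hg, rfl⟩, θ, hθ, ?_⟩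
  rw [Metric.tendsto_atTop']
  intro ε' hε'
  set ε := ε' / 2 with hε
  have hε0 : 0 < ε := by positivity
  suffices hev : ∀ᶠ n in atTop, ‖T (f (θ n) - g)‖ ≤ ε by
    obtain ⟨n₀, hn₀⟩ := eventually_atTop.1 hev
    refine ⟨n₀, fun n hn => ?_⟩
    rw [dist_eq_norm, Function.comp_apply, ← hfy, ← map_sub]
    exact (hn₀ n hn.le).trans_lt (by linarith)
  -- The differences have norm at most `2 < 3 < 2^m ε`; so their modular at scale `2^m ε` is at most
  -- one, and `m` uses of `Δ₂` bring the scale down to `ε`.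
  obtain ⟨m, hm⟩ := pow_unbounded_of_one_lt (3 / ε) one_lt_two
  rw [div_lt_iff₀ hε0] at hm
  obtain ⟨A, B, hA, hB, hΔ⟩ := hψ.exists_orliczModular_le m
  set M := A * 1 + B * bergmanMeasure N α univ with hM
  have hMt : M ≠ ∞ := ENNReal.add_ne_top.2 ⟨ENNReal.mul_ne_top hA ENNReal.one_ne_top,
    ENNReal.mul_ne_top hB (measure_ne_top _ _)⟩
  have hmod : ∀ n, orliczModular ψ (bergmanMeasure N α) (f (θ n) - g).toFun ε ≤ M := by
    intro n
    refine (hΔ _ _ ε hε0).trans ?_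
    have : ‖f (θ n) - g‖ < 2 ^ m * ε :=
      ((norm_sub_le _ _).trans (add_le_add (mem_closedBall_zero_iff.1 (hf _)) hg)).trans_lt
        (by linarith)
    exact add_le_add_left (mul_le_mul_right (BergmanOrlicz.orliczModular_le_one this) _) _
  obtain ⟨η, hη0, hη⟩ := ENNReal.exists_nnreal_pos_mul_lt hMt
    (ENNReal.inv_ne_zero.2 ENNReal.ofNat_ne_top : (2 : ℝ≥0∞)⁻¹ ≠ 0)
  obtain ⟨R, hR, hbdry⟩ := h.exists_lintegral_le hN hα (η := (η : ℝ≥0∞)) (by exact_mod_cast hη0)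
  obtain ⟨τ, hτ0, hτ⟩ := ENNReal.exists_nnreal_pos_mul_lt (measure_ne_top μ univ)
    (ENNReal.inv_ne_zero.2 ENNReal.ofNat_ne_top : (2 : ℝ≥0∞)⁻¹ ≠ 0)
  -- On `‖z‖ ≤ R`, a difference below `ε x` makes the integrand at most `ψ x = τ`, where `τ` times
  -- the total mass is below `1/2`.
  obtain ⟨x, hx0, hx⟩ := ψ.exists_map_eq (A := (τ : ℝ)) τ.2
  have hx0' : 0 < x := by
    rcases eq_or_lt_of_le hx0 with h0 | h0
    · rw [← h0, ψ.map_zero'] at hx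
      exact absurd hx.symm (by exact_mod_cast hτ0.ne')
    · exact h0
  have : LocallyCompactSpace (UnitBall N) := Metric.isOpen_ball.locallyCompactSpace
  have hunif := tendstoLocallyUniformly_iff_forall_isCompact.1 hlim _ (isCompact_norm_le hR)
  rw [Metric.tendstoUniformlyOn_iff] at hunif
  filter_upwards [hunif (ε * x) (by positivity)] with n hn
  refine luxemburgNorm_le hε0 ?_
  refine (orliczModular_comp hϕ (f (θ n) - g).isHolomorphic hε0).trans_le ?_
  have hSm : MeasurableSet {z : UnitBall N | R < ‖(z : E)‖} :=
    (isOpen_lt continuous_const (by fun_prop)).measurableSet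
  rw [← hμ, orliczModular, ← lintegral_add_compl _ hSm, ← ENNReal.inv_two_add_inv_two]
  refine add_le_add ?_ ?_
  · refine (hbdry ψ _ (f (θ n) - g).isHolomorphic ε hε0).trans ?_
    exact (mul_le_mul_right (hmod n) _).trans hη.le
  · calc _ ≤ ∫⁻ z in {z : UnitBall N | R < ‖(z : E)‖}ᶜ, (τ : ℝ≥0∞) ∂μ := by
          refine setLIntegral_mono' hSm.compl fun z hz => ?_
          have h1 := hn z (not_lt.1 hz)
          rw [dist_comm, dist_eq_norm, ← BergmanOrlicz.sub_apply] at h1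
          rw [← ENNReal.ofReal_coe_nnreal, ← hx]
          refine ENNReal.ofReal_le_ofReal (ψ.monotoneOn (mem_Ici.2 (by positivity)) hx0 ?_)
          rw [div_le_iff₀' hε0]
          exact h1.le
      _ ≤ τ * μ univ := by
          rw [setLIntegral_const]
          exact mul_le_mul_right (measure_mono (subset_univ _)) _
      _ ≤ _ := hτ.le

end Composition

/-! ### Necessity: testing the operator on peaking functions -/

section Necessity

variable {N : ℕ} {α : ℝ} {hα : -1 < α} {ψ : OrliczFunction} {ϕ : UnitBall N → UnitBall N}

local notation "E" => EuclideanSpace ℂ (Fin N)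

/-- Bounded test functions concentrated near a boundary point. -/
lemma exists_testFunction (hN : 1 ≤ N) (hα : -1 < α) (ψ : OrliczFunction)
    [IsFiniteMeasure (bergmanMeasure N α)] {k : ℕ} (hk : (N : ℝ) + 1 + α < k) :
    ∃ D : ℝ, 1 ≤ D ∧ ∀ e : E, ‖e‖ = 1 → ∀ h : ℝ, 0 < h → h ≤ 1 → ∀ x : ℝ, 0 ≤ x →
      ψ x = h ^ (-((N : ℝ) + 1 + α)) → ∃ f : BergmanOrlicz N α hα ψ,
        (∀ z : UnitBall N, f z = x * kernelPow e h k z) ∧ ‖f‖ ≤ D := by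
  obtain ⟨C, hC, hint⟩ := exists_lintegral_kernelPow_le hN hα hk
  set p := (N : ℝ) + 1 + α with hp
  refine ⟨max 1 C.toReal, le_max_left _ _, fun e he h h0 h1 x hx0 hx => ?_⟩
  have hhol : IsHolomorphic fun z : UnitBall N => (x : ℂ) * kernelPow e h k z :=
    ⟨fun z => (x : ℂ) * kernelPow e h k z, (differentiableOn_kernelPow he h0 h1 k).const_mul _,
      fun _ => rfl⟩
  -- The kernel is bounded by one, so convexity gives `ψ(x|K|) ≤ |K| ψ x`; the normalization `ψ x =
  -- h^(-p)` then exactly compensates `∫ |K| ≤ C h^p`.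
  have hmod : orliczModular ψ (bergmanMeasure N α)
      (fun z : UnitBall N => (x : ℂ) * kernelPow e h k z) 1 ≤ ENNReal.ofReal (max 1 C.toReal) := by
    calc _ ≤ ∫⁻ z : UnitBall N, ENNReal.ofReal (h ^ (-p)) *
          ENNReal.ofReal ‖kernelPow e h k z‖ ∂(bergmanMeasure N α) := by
          refine lintegral_mono fun z => ?_
          rw [← ENNReal.ofReal_mul (by positivity), div_one, norm_mul, Complex.norm_real,
            Real.norm_of_nonneg hx0, ← hx, mul_comm, mul_comm (ψ x)]
          exact ENNReal.ofReal_le_ofReal (ψ.map_mul_le hx0 (norm_nonneg _)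
            (norm_kernelPow_le_one he h0 h1 k z.norm_lt_one))
      _ ≤ ENNReal.ofReal (h ^ (-p)) * (C * ENNReal.ofReal (h ^ p)) := by
          rw [lintegral_const_mul' _ _ ENNReal.ofReal_ne_top]
          exact mul_le_mul_right (hint e he h h0 h1) _
      _ = C := by
          rw [mul_left_comm, ← ENNReal.ofReal_mul (by positivity), ← Real.rpow_add h0,
            neg_add_cancel, Real.rpow_zero, ENNReal.ofReal_one, mul_one]
      _ ≤ _ := by
          rw [← ENNReal.ofReal_toReal hC]
          refine ENNReal.ofReal_le_ofReal ?_
          rw [ENNReal.toReal_ofReal ENNReal.toReal_nonneg]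
          exact le_max_right _ _
  refine ⟨BergmanOrlicz.mk _ hhol ⟨hhol.continuous.measurable.aemeasurable, 1, one_pos,
    hmod.trans_lt ENNReal.ofReal_lt_top⟩, fun z => rfl, ?_⟩
  have := luxemburgNorm_le_of_orliczModular_le one_pos (le_max_left _ _) hmod
  rwa [one_mul] at this

/-- A norm bound for the image of a test function bounds the measure of a Carleson window. -/
lemma exists_measure_carlesonWindow_le (hα : -1 < α) (hψ : ψ.DeltaTwo)
    (hϕ : IsHolomorphic fun z => (ϕ z : E)) (k : ℕ) {M : ℝ} (hM : 0 < M) :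
    ∃ A > (0 : ℝ), ∃ δ > (0 : ℝ), δ ≤ 1 ∧ ∀ e : E, ‖e‖ = 1 → ∀ h ∈ Ioo 0 δ, ∀ x : ℝ, 0 ≤ x →
      ψ x = h ^ (-((N : ℝ) + 1 + α)) → ∀ f g : BergmanOrlicz N α hα ψ,
        (∀ z : UnitBall N, f z = x * kernelPow e h k z) → (∀ z, g z = f (ϕ z)) →
        ∀ ε : ℝ, 0 < ε → ε ≤ 1 → ‖g‖ < M * ε →
          pullbackMeasure N α ϕ (carlesonWindow e h) ≤
            ENNReal.ofReal (ε * A) * ENNReal.ofReal (h ^ ((N : ℝ) + 1 + α)) := by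
  obtain ⟨x₀, hx₀, K, hK, hΔ⟩ := hψ.exists_map_two_pow_mul_le
  have hp := exponent_pos N hα
  set p := (N : ℝ) + 1 + α with hpdef
  -- With `2^m > 4^k M`, applying `Δ₂` `m` times recovers `ψ x` from `ψ(x/(4^k M))`, at the cost of
  -- `K^m`.
  obtain ⟨m, hm⟩ := pow_unbounded_of_one_lt (4 ^ k * M) one_lt_two
  have hlim : Tendsto (fun h : ℝ => h ^ (-p)) (𝓝[>] 0) atTop :=
    tendsto_rpow_neg_nhdsGT_zero (neg_lt_zero.2 hp)
  -- For `h < δ` the value `x` exceeds `2^m x₀`, so that `x / 2^m` is still in the range where `Δ₂`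
  -- holds.
  obtain ⟨δ, hδ, hsub⟩ := mem_nhdsGT_iff_exists_Ioo_subset.1
    (hlim.eventually_gt_atTop (ψ (2 ^ m * x₀)))
  refine ⟨K ^ m, by positivity, min δ 1, lt_min hδ one_pos, min_le_right _ _, ?_⟩
  intro e he h hh x hx0 hx f g hf hg ε hε hε1 hgn
  have h0 : 0 < h := hh.1
  have h1 : h ≤ 1 := (hh.2.trans_le (min_le_right _ _)).le
  have hx1 : 2 ^ m * x₀ < x := by
    refine ψ.lt_of_map_lt (by positivity) hx0 ?_
    rw [hx]
    exact hsub ⟨h0, hh.2.trans_le (min_le_left _ _)⟩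
  -- `y` is the lower bound for `|f|/(M ε)` on the window. Since `ψ(ε y) ≤ ε ψ(y)`, a norm smaller
  -- by the factor `ε` improves the window estimate by the same factor.
  set y := x / 4 ^ k / (M * ε) with hy
  have hy0 : 0 ≤ y := by positivity
  have hψy : h ^ (-p) / (ε * K ^ m) ≤ ψ y := by
    have h2 : ψ (x / 2 ^ m) ≤ ψ (x / (4 ^ k * M)) := by
      refine ψ.monotoneOn (mem_Ici.2 (by positivity)) (mem_Ici.2 (by positivity)) ?_
      gcongr
    have h3 : ψ x ≤ K ^ m * ψ (x / 2 ^ m) := by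
      have := hΔ m (x / 2 ^ m) (by rw [le_div_iff₀' (by positivity)]; exact hx1.le)
      rwa [mul_div_cancel₀ _ (by positivity)] at this
    have h4 : ψ (x / (4 ^ k * M)) ≤ ε * ψ y := by
      have := ψ.map_mul_le hy0 hε.le hε1
      rwa [show ε * y = x / (4 ^ k * M) by rw [hy]; field_simp] at this
    rw [div_le_iff₀ (by positivity), ← hx]
    calc ψ x ≤ K ^ m * ψ (x / 2 ^ m) := h3
      _ ≤ K ^ m * (ε * ψ y) := by gcongr; exact h2.trans h4
      _ = _ := by ring
  have hmod : orliczModular ψ (pullbackMeasure N α ϕ) f (M * ε) ≤ 1 := by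
    rw [← orliczModular_comp hϕ f.isHolomorphic (by positivity)]
    have := BergmanOrlicz.orliczModular_le_one hgn
    rwa [show (g : UnitBall N → ℂ) = fun z => f (ϕ z) from funext hg] at this
  have hW : MeasurableSet (carlesonWindow e h : Set (UnitBall N)) :=
    (isOpen_carlesonWindow e h).measurableSet
  -- Markov's inequality on the window, where the integrand is at least `ψ y`.
  have hmarkov : ENNReal.ofReal (h ^ (-p) / (ε * K ^ m)) *
      pullbackMeasure N α ϕ (carlesonWindow e h) ≤ 1 := by
    refine le_trans ?_ hmod
    rw [← setLIntegral_const]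
    refine le_trans (setLIntegral_mono' hW fun z hz => ?_) (setLIntegral_le_lintegral _ _)
    refine ENNReal.ofReal_le_ofReal (hψy.trans
      (ψ.monotoneOn (mem_Ici.2 hy0) (mem_Ici.2 (by positivity)) ?_))
    have hk := le_norm_kernelPow_of_mem_carlesonWindow he h0 h1 k hz
    rw [hy, hf, norm_mul, Complex.norm_real, Real.norm_of_nonneg hx0, div_eq_mul_one_div x]
    gcongr
  have hprod : h ^ (-p) / (ε * K ^ m) * (ε * K ^ m * h ^ p) = 1 := by
    rw [Real.rpow_neg h0.le]
    field_simp
  rw [← ENNReal.ofReal_mul (by positivity)]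
  have hpos : 0 < h ^ (-p) / (ε * K ^ m) := by positivity
  rw [← ENNReal.mul_le_mul_iff_right (ENNReal.ofReal_pos.2 hpos).ne' ENNReal.ofReal_ne_top,
    ← ENNReal.ofReal_mul hpos.le, hprod, ENNReal.ofReal_one]
  exact hmarkov

lemma isBergmanCarleson_of_compositionBounded (hN : 1 ≤ N) (hα : -1 < α) (hψ : ψ.DeltaTwo)
    (hϕ : IsHolomorphic fun z => (ϕ z : E)) [IsFiniteMeasure (bergmanMeasure N α)]
    [IsFiniteMeasure (pullbackMeasure N α ϕ)] (h : CompositionBounded N α hα ψ ϕ) :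
    IsBergmanCarleson (pullbackMeasure N α ϕ) α := by
  obtain ⟨T, hT⟩ := h
  obtain ⟨k, hk⟩ := exists_nat_gt ((N : ℝ) + 1 + α)
  obtain ⟨D, hD, htest⟩ := exists_testFunction hN hα ψ hk
  have hM : 0 < ‖T‖ * D + 1 := by positivity
  obtain ⟨A, hA, δ, hδ, hδ1, hwin⟩ := exists_measure_carlesonWindow_le hα hψ hϕ k hM
  refine isBergmanCarleson_of_carlesonRho_le hα hδ (ENNReal.ofReal_ne_top (r := 1 * A)) ?_
  intro t ht
  refine iSup₂_le fun e he => ?_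
  rw [mem_unitSphere_iff] at he
  obtain ⟨x, hx0, hx⟩ := ψ.exists_map_eq (A := t ^ (-((N : ℝ) + 1 + α)))
    (Real.rpow_nonneg ht.1.le _)
  obtain ⟨f, hf, hfD⟩ := htest e he t ht.1 (ht.2.le.trans hδ1) x hx0 hx
  refine hwin e he t ht x hx0 hx f (T f) hf (hT f) 1 one_pos le_rfl ?_
  rw [mul_one]
  refine (T.le_opNorm f).trans_lt ?_
  have : ‖T‖ * ‖f‖ ≤ ‖T‖ * D := by gcongr
  linarith

/-- Otherwise some test functions with `h → 0` have images of norm at least `ε`. By compactness a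
subsequence of the images converges in norm; the test functions tend to zero pointwise, so the limit
is zero, a contradiction. -/
lemma exists_norm_lt_of_compositionCompact (hN : 1 ≤ N) {k : ℕ} (hk : (N : ℝ) + 1 + α < k)
    {T : BergmanOrlicz N α hα ψ →ₗ[ℂ] BergmanOrlicz N α hα ψ} (hT : ∀ f z, T f z = f (ϕ z))
    (hcomp : IsCompactOperator T) (D : ℝ) {ε : ℝ} (hε : 0 < ε) :
    ∃ δ > (0 : ℝ), ∀ e : E, ‖e‖ = 1 → ∀ h ∈ Ioo 0 δ, h ≤ 1 → ∀ x : ℝ, 0 ≤ x →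
      ψ x = h ^ (-((N : ℝ) + 1 + α)) → ∀ f : BergmanOrlicz N α hα ψ,
        (∀ z : UnitBall N, f z = x * kernelPow e h k z) → ‖f‖ ≤ D → ‖T f‖ < ε := by
  have hp := exponent_pos N hα
  set p := (N : ℝ) + 1 + α with hpdef
  by_contra! hcon
  choose e he h hh hh1 x hx0 hx f hf hfD hTf using fun n : ℕ =>
    hcon (1 / ((n : ℝ) + 1)) (by positivity)
  have hlim0 : Tendsto h atTop (𝓝[>] 0) := by
    refine tendsto_nhdsWithin_iff.2 ⟨?_, Eventually.of_forall fun n => (hh n).1⟩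
    exact squeeze_zero (fun n => (hh n).1.le) (fun n => (hh n).2.le)
      tendsto_one_div_add_atTop_nhds_zero_nat
  obtain ⟨S, hS, hsub⟩ := hcomp.image_closedBall_subset_compact D
  obtain ⟨y, -, θ, hθ, hy⟩ := hS.isSeqCompact (x := fun n => T (f n))
    fun n => hsub ⟨f n, mem_closedBall_zero_iff.2 (hfD n), rfl⟩
  obtain ⟨X, hX⟩ := eventually_atTop.1 ((ψ.superlinear'.eventually_ge_atTop 1).and
    (eventually_gt_atTop 0))
  -- Superlinearity gives `x ≤ ψ x = h^(-p)` once `x` is large. So `x` grows at most like `h^(-p)`,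
  -- which the decay `h^k` of the kernel overcomes because `k > p`.
  have hxle : ∀ n, x n ≤ |X| + h n ^ (-p) := by
    intro n
    have h0 : 0 ≤ h n ^ (-p) := Real.rpow_nonneg (hh n).1.le _
    rcases le_total (x n) X with h1 | h1
    · linarith [le_abs_self X]
    · obtain ⟨h2, h3⟩ := hX _ h1
      rw [le_div_iff₀ h3, one_mul, hx] at h2
      linarith [abs_nonneg X]
  have hpt : ∀ w : UnitBall N, Tendsto (fun n => f n w) atTop (𝓝 0) := by
    intro w
    have hw : 0 < 1 - ‖(w : E)‖ := by linarith [w.norm_lt_one]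
    have hk0 : (0 : ℝ) < k := hp.trans hk
    have hb : Tendsto (fun t : ℝ => (|X| * t ^ (k : ℝ) + t ^ ((k : ℝ) - p)) *
        ((1 - ‖(w : E)‖)⁻¹) ^ k) (𝓝[>] 0) (𝓝 0) := by
      have h1 : Tendsto (fun t : ℝ => t ^ (k : ℝ)) (𝓝[>] 0) (𝓝 0) := by
        have := (Real.continuousAt_rpow_const 0 (k : ℝ) (Or.inr hk0.le)).tendsto
        rw [Real.zero_rpow hk0.ne'] at this
        exact this.mono_left nhdsWithin_le_nhds
      have h2 : Tendsto (fun t : ℝ => t ^ ((k : ℝ) - p)) (𝓝[>] 0) (𝓝 0) := by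
        have := (Real.continuousAt_rpow_const 0 ((k : ℝ) - p) (Or.inr (by linarith))).tendsto
        rw [Real.zero_rpow (by linarith)] at this
        exact this.mono_left nhdsWithin_le_nhds
      simpa using ((h1.const_mul |X|).add h2).mul_const (((1 - ‖(w : E)‖)⁻¹) ^ k)
    refine squeeze_zero_norm (fun n => ?_) (hb.comp hlim0)
    have hn := (hh n).1
    rw [hf, norm_mul, Complex.norm_real, Real.norm_of_nonneg (hx0 n), Function.comp_apply]
    have h3 := norm_kernelPow_le (he n) hn (hh1 n) k w.norm_lt_one
    have h4 : 0 ≤ h n ^ (-p) := Real.rpow_nonneg hn.le _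
    calc x n * ‖kernelPow (e n) (h n) k w‖
        ≤ (|X| + h n ^ (-p)) * (h n / (1 - ‖(w : E)‖)) ^ k :=
          mul_le_mul (hxle n) h3 (norm_nonneg _) (by positivity)
      _ = _ := by
          rw [div_eq_mul_inv, mul_pow, ← mul_assoc, add_mul, sub_eq_neg_add (k : ℝ),
            Real.rpow_add hn, Real.rpow_natCast]
  -- Norm limits are pointwise limits, and `T (f n) z = f n (ϕ z)` tends to zero.
  have hy0 : y = 0 := by
    refine BergmanOrlicz.ext fun z => ?_
    have h1 := BergmanOrlicz.tendsto_apply hN hy z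
    refine tendsto_nhds_unique h1 ?_
    have h2 := (hpt (ϕ z)).comp hθ.tendsto_atTop
    simpa only [Function.comp_def, hT, BergmanOrlicz.zero_apply] using h2
  rw [hy0] at hy
  have h1 := hy.norm
  rw [norm_zero] at h1
  exact absurd (ge_of_tendsto' h1 fun n => hTf (θ n)) (not_le.2 hε)

lemma isVanishingBergmanCarleson_of_compositionCompact (hN : 1 ≤ N) (hα : -1 < α)
    (hψ : ψ.DeltaTwo) (hϕ : IsHolomorphic fun z => (ϕ z : E))
    [IsFiniteMeasure (bergmanMeasure N α)] (h : CompositionCompact N α hα ψ ϕ) :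
    IsVanishingBergmanCarleson (pullbackMeasure N α ϕ) α := by
  obtain ⟨T, hT, hcomp⟩ := h
  obtain ⟨k, hk⟩ := exists_nat_gt ((N : ℝ) + 1 + α)
  obtain ⟨D, hD, htest⟩ := exists_testFunction hN hα ψ hk
  obtain ⟨A, hA, δ, hδ, hδ1, hwin⟩ := exists_measure_carlesonWindow_le hα hψ hϕ k one_pos
  rw [IsVanishingBergmanCarleson, ENNReal.tendsto_nhds_zero]
  intro η hη
  -- `c` is chosen with `c A < η`, the tolerance for the quotient; the cap at one in `ε` is what the
  -- convexity step of the window estimate requires.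
  obtain ⟨c, hc0, hc⟩ := ENNReal.exists_nnreal_pos_mul_lt
    (ENNReal.ofReal_ne_top (r := A)) hη.ne'
  set ε : ℝ := min c 1 with hε
  have hε0 : 0 < ε := lt_min (by exact_mod_cast hc0) one_pos
  obtain ⟨δ', hδ', hsmall⟩ := exists_norm_lt_of_compositionCompact hN hk hT hcomp D hε0
  filter_upwards [Ioo_mem_nhdsGT (lt_min hδ hδ')] with t ht
  have ht1 : t ∈ Ioo 0 δ := ⟨ht.1, ht.2.trans_le (min_le_left _ _)⟩
  have ht2 : t ∈ Ioo 0 δ' := ⟨ht.1, ht.2.trans_le (min_le_right _ _)⟩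
  have ht3 : t ≤ 1 := ht1.2.le.trans hδ1
  refine ENNReal.div_le_of_le_mul (iSup₂_le fun e he => ?_)
  rw [mem_unitSphere_iff] at he
  obtain ⟨x, hx0, hx⟩ := ψ.exists_map_eq (A := t ^ (-((N : ℝ) + 1 + α)))
    (Real.rpow_nonneg ht.1.le _)
  obtain ⟨f, hf, hfD⟩ := htest e he t ht.1 ht3 x hx0 hx
  refine (hwin e he t ht1 x hx0 hx f (T f) hf (hT f) ε hε0 (min_le_right _ _) ?_).trans ?_
  · rw [one_mul]
    exact hsmall e he t ht2 ht3 x hx0 hx f hf hfD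
  · refine mul_le_mul_left (le_trans ?_ hc.le) _
    rw [← ENNReal.ofReal_coe_nnreal, ← ENNReal.ofReal_mul c.coe_nonneg]
    exact ENNReal.ofReal_le_ofReal (mul_le_mul_of_nonneg_right (min_le_left _ _) hA.le)

end Necessity

end

theorem theorem3p3 (N : ℕ) (hN : 1 ≤ N) (α : ℝ) (hα : -1 < α)
    (ψ : OrliczFunction) (hψ : ψ.DeltaTwo)
    (ϕ : UnitBall N → UnitBall N)
    (hϕ : IsHolomorphic fun z => (ϕ z : EuclideanSpace ℂ (Fin N))) :
    (CompositionBounded N α hα ψ ϕ ↔ IsBergmanCarleson (pullbackMeasure N α ϕ) α) ∧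
      (CompositionCompact N α hα ψ ϕ ↔
        IsVanishingBergmanCarleson (pullbackMeasure N α ϕ) α) := by
  have hfin := isFiniteMeasure_bergmanMeasure hN hα
  have hfin' : IsFiniteMeasure (pullbackMeasure N α ϕ) := by
    unfold pullbackMeasure
    infer_instance
  exact ⟨⟨isBergmanCarleson_of_compositionBounded hN hα hψ hϕ,
    compositionBounded_of_isBergmanCarleson hN hα hϕ⟩,
    ⟨isVanishingBergmanCarleson_of_compositionCompact hN hα hψ hϕ,
    compositionCompact_of_isVanishingBergmanCarleson hN hα hψ hϕ⟩⟩
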